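/- Let $K\in\mathbb{N}$, let $\mathcal X_1,\dots,\mathcal X_K$ be finite alphabets, and let $(x_1,\dots,x_K)\mapsto\rho_{x_1,\dots,x_K}$ be a classical-input quantum-output multiple-access channel, i.e. each $\rho_{x_1,\dots,x_K}$ is a density operator on a fixed finite-dimensional Hilbert space $C$. For $n$ memoryless uses, write $\rho_{x_1^n,\dots,x_K^n}=\bigotimes_{i=1}^n\rho_{x_{1,i},\dots,x_{K,i}}$. Let $p_{X_k}$ be a probability distribution on $\mathcal X_k$ for every $k\in[K]=\{1,\dots,K\}$, and set $$\omega_{X_1\cdots X_KC}=\sum_{x_1,\dots,x_K}p_{X_1}(x_1)\cdots p_{X_K}(x_K)\,|x_1\rangle\langle x_1|_{X_1}\otimes\cdots\otimes|x_K\rangle\langle x_K|_{X_K}\otimes\rho_{x_1,\dots,x_K}.$$ For $\mathcal J\subseteq[K]$ let $X(\mathcal J)=(X_j)_{j\in\mathcal J}$ and $$\tilde I(X(\mathcal J);CX(\mathcal J^c))_\omega=H_2(X(\mathcal J^c)C)_\omega-H(X(\mathcal J^c)C|X(\mathcal J))_\omega,$$ where $H_2(A)_\sigma=-\log_2\operatorname{Tr}\{\sigma_A^2\}$,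 $H(A)_\sigma=-\operatorname{Tr}\{\sigma_A\log_2\sigma_A\}$ and $H(A|B)_\sigma=H(AB)_\sigma-H(B)_\sigma$. An unassisted code of blocklength $n$ with $M_k$ messages for sender $k$ consists of codewords $x_k^n(m_k)\in\mathcal X_k^n$, $m_k\in\{1,\dots,M_k\}$, and a decoding POVM on $C^n$ with an outcome operator $\Lambda_{m_1,\dots,m_K}$ for every message tuple and a failure outcome. Its average error probability is $$\frac{1}{M_1\cdots M_K}\sum_{m_1,\dots,m_K}\operatorname{Tr}\{(I-\Lambda_{m_1,\dots,m_K})\,\rho_{x_1^n(m_1),\dots,x_K^n(m_K)}\}.$$ A quantum simultaneous decoder of blocklength $n$ is given by test operators $0\le Q^{x_1^n,\dots,x_K^n}\le I$ on $C^n$, one for every tuple of input words and not depending on the codewords; for given codewords it decodes all messages at once with the square-root measurement $$\Lambda_m=S^{-1/2}\,Q^{x_1^n(m_1),\dots,x_K^n(m_K)}\,S^{-1/2},\qquad S=\sum_{m'}Q^{x_1^n(m'_1),\dots,x_K^n(m'_K)},$$ where $m=(m_1,\dots,m_K)$ and the inverse square root is taken on the support of $S$. **Theorem.** Suppose that the real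 numbers $R_1,\dots,R_K$ satisfy $$\sum_{j\in\mathcal J}R_j\le\tilde I(X(\mathcal J);CX(\mathcal J^c))_\omega\qquad\text{for every nonempty }\mathcal J\subseteq[K].$$ Then the rates $(R_1,\dots,R_K)$ are achievable with a quantum simultaneous decoder: for all $\varepsilon\in(0,1)$, all $\delta>0$ and all sufficiently large $n$ there are message numbers $M_k\ge2^{n(R_k-\delta)}$, $k\in[K]$, and a quantum simultaneous decoder of blocklength $n$ such that (i) if all letters of the codewords of each sender $k$ are drawn independently from $p_{X_k}$, independently for different senders, and are known to the receiver, then the expected average error probability is at most $\varepsilon$, and (ii) there are fixed codewords for which the resulting unassisted code has average error probability at most $\varepsilon$. -/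

import Mathlib

universe u v

open scoped ComplexOrder

namespace CQMAC

/-! ### States, measurements and entropies in finite dimension -/

/-- A density operator: positive semi-definite with unit trace. -/
def IsDensityOperator {d : Type v} [Fintype d] (ρ : Matrix d d ℂ) : Prop :=
  ρ.PosSemidef ∧ ρ.trace = 1

/-- A positive operator-valued measure with finitely many outcomes. -/
def IsPOVM {ι : Type u} [Fintype ι] {d : Type v} [Fintype d] [DecidableEq d]
    (E : ι → Matrix d d ℂ) : Prop :=
  (∀ i, (E i).PosSemidef) ∧ ∑ i, E i = 1

/-- The von Neumann entropy `H(ρ) = -Tr{ρ log₂ ρ}` (with `0 log₂ 0 = 0`). -/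
noncomputable def vonNeumannEntropy {d : Type v} [Fintype d] [DecidableEq d]
    (ρ : Matrix d d ℂ) : ℝ :=
  -(cfc (fun t : ℝ => t * Real.logb 2 t) ρ).trace.re

/-- The Rényi entropy of order two `H₂(ρ) = -log₂ Tr{ρ²}`. -/
noncomputable def renyiTwoEntropy {d : Type v} [Fintype d] (ρ : Matrix d d ℂ) : ℝ :=
  -Real.logb 2 (ρ * ρ).trace.re

/-- The tensor product `A 0 ⊗ ⋯ ⊗ A (n-1)`, in the product basis. -/
def tensor {d : Type v} {n : ℕ} (A : Fin n → Matrix d d ℂ) :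
    Matrix (Fin n → d) (Fin n → d) ℂ :=
  Matrix.of fun a b => ∏ i, A i (a i) (b i)

/-- The inverse square root `S^{-1/2}` of a positive semi-definite matrix, taken on its support
(and zero on its kernel, since `(√0)⁻¹ = 0`). -/
noncomputable def invSqrt {d : Type v} [Fintype d] [DecidableEq d]
    (S : Matrix d d ℂ) : Matrix d d ℂ :=
  cfc (fun t : ℝ => (√t)⁻¹) S

/-- The square-root measurement operators `(∑ G_j)^{-1/2} G_i (∑ G_j)^{-1/2}`. -/
noncomputable def squareRootMeas {ι : Type u} [Fintype ι] {d : Type v} [Fintype d] [DecidableEq d]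
    (G : ι → Matrix d d ℂ) (i : ι) : Matrix d d ℂ :=
  invSqrt (∑ j, G j) * G i * invSqrt (∑ j, G j)

/-- The square-root measurement, completed to a POVM by the failure outcome `none`. -/
noncomputable def squareRootPOVM {ι : Type u} [Fintype ι] {d : Type v} [Fintype d]
    [DecidableEq d] (G : ι → Matrix d d ℂ) : Option ι → Matrix d d ℂ
  | none => 1 - ∑ i, squareRootMeas G i
  | some i => squareRootMeas G i

theorem invSqrt_isHermitian {d : Type v} [Fintype d] [DecidableEq d] (S : Matrix d d ℂ) :
    (invSqrt S).IsHermitian :=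
  (cfc_predicate (fun t : ℝ => (√t)⁻¹) S : IsSelfAdjoint _)

open scoped MatrixOrder in
theorem posSemidef_one_sub_invSqrt {d : Type v} [Fintype d] [DecidableEq d]
    {S : Matrix d d ℂ} (hS : S.PosSemidef) :
    (1 - invSqrt S * S * invSqrt S).PosSemidef := by
  have hsa : IsSelfAdjoint S := hS.isHermitian
  have hc : ∀ f : ℝ → ℝ, ContinuousOn f (spectrum ℝ S) := fun f =>
    (Matrix.finite_real_spectrum (A := S)).continuousOn f
  have h1 : invSqrt S * S * invSqrt S = cfc (fun t : ℝ => (√t)⁻¹ * t * (√t)⁻¹) S := by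
    rw [cfc_mul _ _ S (hc _) (hc _), cfc_mul _ _ S (hc _) (hc _), cfc_id' ℝ S]
    rfl
  rw [h1, ← Matrix.le_iff]
  refine cfc_le_one _ S fun t ht => ?_
  have ht0 : 0 ≤ t := spectrum_nonneg_of_nonneg (Matrix.nonneg_iff_posSemidef.2 hS) ht
  rcases ht0.eq_or_lt with h | h
  · simp [← h]
  · have hs : √t ≠ 0 := (Real.sqrt_pos.2 h).ne'
    have : (√t)⁻¹ * t * (√t)⁻¹ = 1 := by
      nth_rewrite 2 [← Real.mul_self_sqrt ht0]
      field_simp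
    exact this.le

theorem squareRootPOVM_isPOVM {ι : Type u} [Fintype ι] {d : Type v} [Fintype d]
    [DecidableEq d] (G : ι → Matrix d d ℂ) (hG : ∀ i, (G i).PosSemidef) :
    IsPOVM (squareRootPOVM G) := by
  refine ⟨?_, ?_⟩
  · rintro (_ | i)
    · have h : ∑ i, squareRootMeas G i
          = invSqrt (∑ j, G j) * (∑ j, G j) * invSqrt (∑ j, G j) := by
        simp only [squareRootMeas, Finset.mul_sum, Finset.sum_mul]
      show (1 - ∑ i, squareRootMeas G i).PosSemidef
      rw [h]
      exact posSemidef_one_sub_invSqrt (Matrix.posSemidef_sum _ fun i _ => hG i)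
    · have h := (hG i).conjTranspose_mul_mul_same (invSqrt (∑ j, G j))
      rw [(invSqrt_isHermitian _).eq] at h
      exact h
  · rw [Fintype.sum_option]
    simp [squareRootPOVM]

/-! ### The classical-quantum state and the information quantities

The channel is a family of output states `ρ x` on system `C`, indexed by input tuples
`x : ∀ k, X k`; sender `k` has input alphabet `X k`. The registers `X_1 ⋯ X_K` together have
the product basis indexed by `∀ k, X k`. -/

variable {K : ℕ} {X : Fin K → Type u} [∀ k, Fintype (X k)] [∀ k, DecidableEq (X k)]
  {d : Type v} [Fintype d] [DecidableEq d]

/-- `ω = ∑ p_1(x_1) ⋯ p_K(x_K) |x_1 ⋯ x_K⟩⟨x_1 ⋯ x_K| ⊗ ρ_{x_1, …, x_K}`. -/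
noncomputable def cqState (p : ∀ k, X k → ℝ) (ρ : (∀ k, X k) → Matrix d d ℂ) :
    Matrix ((∀ k, X k) × d) ((∀ k, X k) × d) ℂ :=
  ∑ x, ((∏ k, p k (x k) : ℝ) : ℂ) • Matrix.kronecker (Matrix.single x x 1) (ρ x)

/-- The reduced state on `X(S) C`: the partial trace over the registers outside `S`. -/
def marginalXC (S : Finset (Fin K)) (ω : Matrix ((∀ k, X k) × d) ((∀ k, X k) × d) ℂ) :
    Matrix ((∀ k : {k // k ∈ S}, X k) × d) ((∀ k : {k // k ∈ S}, X k) × d) ℂ :=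
  Matrix.of fun a b => ∑ z : (∀ k : {k // ¬ k ∈ S}, X k),
    ω ((Equiv.piEquivPiSubtypeProd (fun k => k ∈ S) X).symm (a.1, z), a.2)
      ((Equiv.piEquivPiSubtypeProd (fun k => k ∈ S) X).symm (b.1, z), b.2)

/-- The reduced state on `X(S)`: the partial trace over `C` of the reduced state on `X(S) C`. -/
def marginalX (S : Finset (Fin K)) (ω : Matrix ((∀ k, X k) × d) ((∀ k, X k) × d) ℂ) :
    Matrix (∀ k : {k // k ∈ S}, X k) (∀ k : {k // k ∈ S}, X k) ℂ :=
  Matrix.of fun a b => ∑ c : d, marginalXC S ω (a, c) (b, c)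

/-- The conditional entropy `H(X(Jᶜ) C | X(J)) = H(X_1 ⋯ X_K C) - H(X(J))`. -/
noncomputable def condEntropy (J : Finset (Fin K))
    (ω : Matrix ((∀ k, X k) × d) ((∀ k, X k) × d) ℂ) : ℝ :=
  vonNeumannEntropy ω - vonNeumannEntropy (marginalX J ω)

/-- `Ĩ(X(J); C X(Jᶜ)) = H₂(X(Jᶜ) C) - H(X(Jᶜ) C | X(J))`. -/
noncomputable def renyiInfo (J : Finset (Fin K))
    (ω : Matrix ((∀ k, X k) × d) ((∀ k, X k) × d) ℂ) : ℝ :=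
  renyiTwoEntropy (marginalXC Jᶜ ω) - condEntropy J ω

/-! ### Codes -/

/-- Codebooks for `n` channel uses: sender `k` has `M k` codewords of length `n`. -/
abbrev Codebook (X : Fin K → Type u) (n : ℕ) (M : Fin K → ℕ) : Type u :=
  ∀ k, Fin (M k) → Fin n → X k

/-- The output state of `n` memoryless uses of the channel on the input words `x 1, …, x K`. -/
def channelOutput (ρ : (∀ k, X k) → Matrix d d ℂ) {n : ℕ} (x : ∀ k, Fin n → X k) :
    Matrix (Fin n → d) (Fin n → d) ℂ :=
  tensor fun i => ρ fun k => x k i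

/-- An unassisted code: codebooks, and a decoding POVM on the channel output whose outcomes are
the message tuples and a failure outcome `none`. -/
structure Code (X : Fin K → Type u) (d : Type v) [Fintype d] [DecidableEq d] (n : ℕ)
    (M : Fin K → ℕ) where
  codebook : Codebook X n M
  povm : Option (∀ k, Fin (M k)) → Matrix (Fin n → d) (Fin n → d) ℂ
  isPOVM : IsPOVM povm

/-- `p_e(m) = Tr{(I - Λ_m) ρ_{x_1(m_1), …, x_K(m_K)}}`. -/
noncomputable def Code.errorProb {n : ℕ} {M : Fin K → ℕ} (c : Code X d n M)
    (ρ : (∀ k, X k) → Matrix d d ℂ) (m : ∀ k, Fin (M k)) : ℝ :=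
  ((1 - c.povm (some m)) * channelOutput ρ fun k => c.codebook k (m k)).trace.re

/-- The error probability averaged over all message tuples. -/
noncomputable def Code.avgError {n : ℕ} {M : Fin K → ℕ} (c : Code X d n M)
    (ρ : (∀ k, X k) → Matrix d d ℂ) : ℝ :=
  (∏ k, (M k : ℝ))⁻¹ * ∑ m, c.errorProb ρ m

/-- A simultaneous decoder for blocklength `n`: a test operator `0 ≤ Q ≤ I` for every tuple of
input words, not depending on the codebooks. -/
structure SimultaneousDecoder (X : Fin K → Type u) (d : Type v) [Fintype d] [DecidableEq d]
    (n : ℕ) where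
  test : (∀ k, Fin n → X k) → Matrix (Fin n → d) (Fin n → d) ℂ
  test_nonneg : ∀ x, (test x).PosSemidef
  test_le_one : ∀ x, (1 - test x).PosSemidef

/-- The code in which the receiver decodes all messages at once by the square-root measurement of
the test operators `Q^{x_1(m_1), …, x_K(m_K)}` of all tuples of codewords. -/
noncomputable def SimultaneousDecoder.code {n : ℕ} {M : Fin K → ℕ}
    (D : SimultaneousDecoder X d n) (x : Codebook X n M) : Code X d n M where
  codebook := x
  povm := squareRootPOVM fun m : (∀ k, Fin (M k)) => D.test fun k => x k (m k)
  isPOVM := squareRootPOVM_isPOVM _ fun _ => D.test_nonneg _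

/-- The probability of a codebook when every letter of every codeword of sender `k` is drawn
independently from `p k`. -/
def codebookProb (p : ∀ k, X k → ℝ) {n : ℕ} {M : Fin K → ℕ} (x : Codebook X n M) : ℝ :=
  ∏ k, ∏ m, ∏ i, p k (x k m i)

/-- The rates `R` are achievable with a simultaneous decoder and input distributions `p`: for all
`ε ∈ (0,1)`, all `δ > 0` and all sufficiently large `n` there are at least `2^{n(R_k - δ)}`
messages for every sender `k`, and a simultaneous decoder that has average error at most `ε`
both in expectation over shared random codebooks and for some fixed choice of the codebooks,
the latter being an unassisted code. -/
def AchievableSimultaneously (p : ∀ k, X k → ℝ) (ρ : (∀ k, X k) → Matrix d d ℂ)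
    (R : Fin K → ℝ) : Prop :=
  ∀ ε : ℝ, 0 < ε → ε < 1 → ∀ δ : ℝ, 0 < δ → ∀ᶠ n : ℕ in Filter.atTop,
    ∃ M : Fin K → ℕ, (∀ k, (2 : ℝ) ^ ((n : ℝ) * (R k - δ)) ≤ (M k : ℝ)) ∧
      ∃ D : SimultaneousDecoder X d n,
        (∑ x : Codebook X n M, codebookProb p x * (D.code x).avgError ρ ≤ ε) ∧
        ∃ x : Codebook X n M, (D.code x).avgError ρ ≤ ε

end CQMAC

set_option linter.unusedSectionVars false

namespace CQMAC

/-! ### A Chernoff bound for finite distributions -/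

/-! The proof is random coding with one typical projector per tuple of input words. Diagonalise
every ρ_x. The test for words u projects onto those product eigenvectors y of ρ_u for which
p(u)λ_u(y) ≥ 2^{-n(H(X_1⋯X_K C)+δ/4)} and p_J(u) ≤ 2^{-n(H(X(J))-δ/4)} for every J. All these
conditions concern classical words and an index in a single eigenbasis, so they can be imposed
together, and no noncommuting projectors have to be combined.

The Hayashi–Nagaoka inequality (`hayashi_nagaoka`) splits the error into rejection of the sent
tuple, exponentially unlikely by Chernoff bounds, and acceptance of wrong tuples. The wrong tuples
are grouped by the set J of senders whose message differs (`expected_avgError_le`): the wrong words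
u and the sent words v are independent on J and equal on Jᶜ.

Typicality gives the operator inequality Q^u ≤ 2^{n(H(X(Jᶜ)C|X(J))+δ/2)} p_{Jᶜ}(u) ρ_u. The average
of p_{Jᶜ}(u) Tr{ρ_u ρ_v} over such pairs is exactly the n-th power of the purity of ω on X(Jᶜ)C,
that is 2^{-nH₂(X(Jᶜ)C)}; this is where the Rényi entropy enters (`purity_marginalXC`,
`sum_pairWeight_purity`, `sum_pairWeight_eigenTest_le`). At most 2^{n(∑_J R_j-δ)} wrong tuples
belong to J, so J contributes at most a constant times 2^{-nδ/2}. A fixed codebook exists because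
the minimum is at most the mean. -/

theorem exists_exp_moment_lt_one {Z : Type*} [Fintype Z] {q : Z → ℝ} (hq : ∑ z, q z = 1)
    (g : Z → ℝ) {δ : ℝ} (hδ : 0 < δ) :
    ∃ t : ℝ, 0 < t ∧ ∑ z, q z * Real.exp (t * (g z - (∑ z, q z * g z + δ))) < 1 := by
  set c := ∑ z, q z * g z + δ with hc
  set φ : ℝ → ℝ := fun t => ∑ z, q z * Real.exp (t * (g z - c)) with hφ
  -- The moment equals 1 at t = 0 with derivative -δ there, so it is below 1 just to the right of 0.
  have hd : HasDerivAt φ (∑ z, q z * (g z - c)) 0 := by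
    refine HasDerivAt.fun_sum fun z _ => ?_
    have h1 := ((hasDerivAt_id (0 : ℝ)).mul_const (g z - c)).exp.const_mul (q z)
    simpa using h1
  have hneg : ∑ z, q z * (g z - c) < 0 := by
    have : ∑ z, q z * (g z - c) = -δ := by
      simp only [mul_sub, Finset.sum_sub_distrib, ← Finset.sum_mul, hq]
      rw [hc]; ring
    linarith
  have h0 : φ 0 = 1 := by simp [hφ, hq]
  have hslope := (hasDerivAt_iff_tendsto_slope.1 hd).mono_left
    (nhdsWithin_mono 0 (fun x (hx : x ∈ Set.Ioi (0 : ℝ)) => ne_of_gt hx))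
  have hev := (hslope.eventually (gt_mem_nhds hneg)).and self_mem_nhdsWithin
  obtain ⟨t, ht, htpos⟩ := hev.exists
  have htpos' : 0 < t := htpos
  refine ⟨t, htpos', ?_⟩
  rw [slope_def_field, h0, sub_zero, div_neg_iff] at ht
  rcases ht with h | h
  · linarith [h.2]
  · have := h.1
    simp only [hφ] at this
    linarith

/-- Exponential Markov inequality: the n-th power of the moment expands into a sum over words, and
on the event `P` the exponential factor is at least 1. The deviation is required only on words of
nonzero probability, which allows g to be a logarithm of a probability that may vanish. -/
theorem exists_chernoff_rate {Z : Type*} [Fintype Z] {q : Z → ℝ} (hq0 : ∀ z, 0 ≤ q z)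
    (hq : ∑ z, q z = 1) (g : Z → ℝ) {δ : ℝ} (hδ : 0 < δ) :
    ∃ r : ℝ, 0 ≤ r ∧ r < 1 ∧ ∀ (n : ℕ) (P : (Fin n → Z) → Prop) [DecidablePred P],
      (∀ z, P z → (∏ i, q (z i)) ≠ 0 → n * (∑ z, q z * g z + δ) ≤ ∑ i, g (z i)) →
      ∑ z : Fin n → Z, (if P z then ∏ i, q (z i) else 0) ≤ r ^ n := by
  obtain ⟨t, ht, hlt⟩ := exists_exp_moment_lt_one hq g hδ
  refine ⟨_, Finset.sum_nonneg fun z _ => mul_nonneg (hq0 z) (Real.exp_pos _).le, hlt, ?_⟩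
  intro n P _ hP
  rw [Fintype.sum_pow]
  refine Finset.sum_le_sum fun z _ => ?_
  rw [Finset.prod_mul_distrib, ← Real.exp_sum, ← Finset.mul_sum, Finset.sum_sub_distrib]
  have hnn : 0 ≤ ∏ i, q (z i) := Finset.prod_nonneg fun i _ => hq0 _
  split_ifs with h
  · rcases eq_or_ne (∏ i, q (z i)) 0 with h0 | h0
    · simp [h0]
    refine le_mul_of_one_le_right hnn (Real.one_le_exp (mul_nonneg ht.le ?_))
    have := hP z h h0
    simp only [Finset.sum_const, Finset.card_univ, Fintype.card_fin, nsmul_eq_mul]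
    linarith
  · exact mul_nonneg hnn (Real.exp_pos _).le

/-- Products of probabilities exceeding `2^{n(E log₂ f + δ)}` are exponentially unlikely. -/
theorem exists_rate_prod_gt {Z : Type*} [Fintype Z] {q : Z → ℝ} (hq0 : ∀ z, 0 ≤ q z)
    (hq : ∑ z, q z = 1) (f : Z → ℝ) {δ : ℝ} (hδ : 0 < δ) :
    ∃ r : ℝ, 0 ≤ r ∧ r < 1 ∧ ∀ n : ℕ,
      ∑ z : Fin n → Z, (if ∏ i, f (z i) ≤
        (2 : ℝ) ^ ((n : ℝ) * (∑ z, q z * Real.logb 2 (f z) + δ))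
        then 0 else ∏ i, q (z i)) ≤ r ^ n := by
  obtain ⟨r, h0, h1, h⟩ := exists_chernoff_rate hq0 hq (fun z => Real.logb 2 (f z)) hδ
  refine ⟨r, h0, h1, fun n => ?_⟩
  classical
  refine le_trans (Finset.sum_le_sum fun z _ => ?_)
    (h n (fun z => ¬ ∏ i, f (z i) ≤ (2 : ℝ) ^ ((n : ℝ) * (∑ z, q z * Real.logb 2 (f z) + δ))) ?_)
  · rw [ite_not]
  · intro z hz _
    rw [not_le] at hz
    -- The threshold is positive, so no factor vanishes on this event and the convention log₂ 0 = 0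
    -- does no harm.
    have hpos : 0 < ∏ i, f (z i) := lt_trans (by positivity) hz
    have hne : ∀ i ∈ Finset.univ, f (z i) ≠ 0 := Finset.prod_ne_zero_iff.1 hpos.ne'
    rw [← Real.logb_prod _ _ hne]
    exact ((Real.lt_logb_iff_rpow_lt (by norm_num) hpos).2 hz).le

/-- Products of probabilities below `2^{n(E log₂ f - δ)}` are exponentially unlikely. -/
theorem exists_rate_prod_lt {Z : Type*} [Fintype Z] {q : Z → ℝ} (hq0 : ∀ z, 0 ≤ q z)
    (hq : ∑ z, q z = 1) {δ : ℝ} (hδ : 0 < δ) :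
    ∃ r : ℝ, 0 ≤ r ∧ r < 1 ∧ ∀ n : ℕ,
      ∑ z : Fin n → Z, (if (2 : ℝ) ^ ((n : ℝ) * (∑ z, q z * Real.logb 2 (q z) - δ)) ≤
        ∏ i, q (z i) then 0 else ∏ i, q (z i)) ≤ r ^ n := by
  obtain ⟨r, h0, h1, h⟩ := exists_chernoff_rate hq0 hq (fun z => -Real.logb 2 (q z)) hδ
  refine ⟨r, h0, h1, fun n => ?_⟩
  classical
  refine le_trans (Finset.sum_le_sum fun z _ => ?_)
    (h n (fun z => ¬ (2 : ℝ) ^ ((n : ℝ) * (∑ z, q z * Real.logb 2 (q z) - δ)) ≤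
        ∏ i, q (z i)) ?_)
  · rw [ite_not]
  · intro z hz hz0
    rw [not_le] at hz
    have hpos : 0 < ∏ i, q (z i) := lt_of_le_of_ne (Finset.prod_nonneg fun i _ => hq0 _) hz0.symm
    have hne : ∀ i ∈ Finset.univ, q (z i) ≠ 0 := Finset.prod_ne_zero_iff.1 hpos.ne'
    rw [Finset.sum_neg_distrib, ← Real.logb_prod _ _ hne]
    have := ((Real.logb_lt_iff_lt_rpow (by norm_num) hpos).2 hz).le
    simp only [mul_neg, Finset.sum_neg_distrib]
    linarith

/-! ### Traces and unitary diagonalisation -/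

section Matrices
variable {d : Type v} [Fintype d] [DecidableEq d]

/-- The matrix has the same characteristic polynomial as the diagonal one, so its eigenvalues are
the q i as a multiset, and the trace of f depends only on that multiset. -/
theorem trace_cfc_conj_diagonal {U : Matrix d d ℂ} (hU : U ∈ Matrix.unitaryGroup d ℂ)
    (q : d → ℝ) (f : ℝ → ℝ) :
    (cfc f (U * Matrix.diagonal (fun i => (q i : ℂ)) * star U)).trace.re = ∑ i, f (q i) := by
  set A := U * Matrix.diagonal (fun i => (q i : ℂ)) * star U with hA
  have hD : (Matrix.diagonal (fun i => (q i : ℂ))).IsHermitian := by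
    simp [Matrix.IsHermitian, Matrix.diagonal_conjTranspose, Pi.star_def]
  have hAh : A.IsHermitian := Matrix.isHermitian_mul_mul_conjTranspose U hD
  have hchar : A.charpoly = (Matrix.diagonal (fun i => (q i : ℂ))).charpoly := by
    rw [hA, Matrix.mul_assoc, Matrix.charpoly_mul_comm, Matrix.mul_assoc,
      (Matrix.mem_unitaryGroup_iff').1 hU, Matrix.mul_one]
  have hroots := congrArg Polynomial.roots hchar
  rw [hAh.roots_charpoly_eq_eigenvalues, Matrix.charpoly_diagonal,
    Polynomial.roots_prod _ _ (Finset.prod_ne_zero_iff.2 fun i _ => Polynomial.X_sub_C_ne_zero _)]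
    at hroots
  simp only [Polynomial.roots_X_sub_C, Multiset.bind_singleton] at hroots
  have hre := congrArg (Multiset.map fun z : ℂ => f z.re) hroots
  rw [Multiset.map_map, Multiset.map_map] at hre
  have hsum := congrArg Multiset.sum hre
  rw [hAh.cfc_eq f, Matrix.IsHermitian.cfc, Unitary.conjStarAlgAut_apply, Matrix.mul_assoc,
    Matrix.trace_mul_comm, Matrix.mul_assoc, Unitary.coe_star_mul_self, Matrix.mul_one,
    Matrix.trace_diagonal]
  rw [Complex.re_sum]
  exact hsum

open scoped MatrixOrder in
theorem trace_mul_re_nonneg {A B : Matrix d d ℂ} (hA : A.PosSemidef) (hB : B.PosSemidef) :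
    0 ≤ (A * B).trace.re := by
  obtain ⟨C, rfl⟩ := CStarAlgebra.nonneg_iff_eq_star_mul_self.1 hA.nonneg
  rw [Matrix.mul_assoc, Matrix.trace_mul_comm]
  exact (Complex.le_def.1 (hB.mul_mul_conjTranspose_same C).trace_nonneg).1

/-! ### The Hayashi–Nagaoka inequality -/

open scoped MatrixOrder Matrix.Norms.L2Operator in
-- Operator monotonicity of the square root.
theorem posSemidef_sub_of_mul_self_le {L Q : Matrix d d ℂ} (hL : L.PosSemidef)
    (hQ : Q.PosSemidef) (h : (L * L - Q * Q).PosSemidef) : (L - Q).PosSemidef := by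
  have h1 : CFC.sqrt (Q * Q) ≤ CFC.sqrt (L * L) := CFC.sqrt_le_sqrt _ _ (Matrix.le_iff.2 h)
  rwa [CFC.sqrt_mul_self Q hQ.nonneg, CFC.sqrt_mul_self L hL.nonneg, Matrix.le_iff] at h1

open scoped MatrixOrder in
-- The relation t^{-1/2} t = t^{1/2} survives at t = 0, where both sides are 0, so no invertibility
-- of S is needed.
theorem exists_sqrt_invSqrt {S : Matrix d d ℂ} (hS : S.PosSemidef) :
    ∃ L : Matrix d d ℂ, L.PosSemidef ∧ L * L = S ∧ invSqrt S * S = L ∧ S * invSqrt S = L := by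
  have hsa : IsSelfAdjoint S := hS.isHermitian
  have hc : ∀ f : ℝ → ℝ, ContinuousOn f (spectrum ℝ S) := fun f =>
    (Matrix.finite_real_spectrum (A := S)).continuousOn f
  have hpos : ∀ t ∈ spectrum ℝ S, 0 ≤ t := fun t ht =>
    spectrum_nonneg_of_nonneg (Matrix.nonneg_iff_posSemidef.2 hS) ht
  have hinv : ∀ t : ℝ, 0 ≤ t → (√t)⁻¹ * t = √t := fun t ht => by
    rcases ht.eq_or_lt with h | h
    · simp [← h]
    · have hs : √t ≠ 0 := (Real.sqrt_pos.2 h).ne'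
      nth_rewrite 2 [← Real.mul_self_sqrt ht]
      field_simp
  have hid : cfc (fun t : ℝ => t) S = S := cfc_id' ℝ S
  refine ⟨cfc Real.sqrt S, ?_, ?_, ?_, ?_⟩
  · exact Matrix.nonneg_iff_posSemidef.1 (cfc_nonneg fun t _ => Real.sqrt_nonneg t)
  · rw [← cfc_mul _ _ S (hc _) (hc _)]
    nth_rewrite 2 [← hid]
    exact cfc_congr fun t ht => Real.mul_self_sqrt (hpos t ht)
  · rw [invSqrt]
    nth_rewrite 2 [← hid]
    rw [← cfc_mul _ _ S (hc _) (hc _)]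
    exact cfc_congr fun t ht => hinv t (hpos t ht)
  · rw [invSqrt]
    nth_rewrite 1 [← hid]
    rw [← cfc_mul _ _ S (hc _) (hc _)]
    exact cfc_congr fun t ht => by rw [mul_comm]; exact hinv t (hpos t ht)

/-- The Hayashi–Nagaoka inequality
`1 - (Q + T)^{-1/2} Q (Q + T)^{-1/2} ≤ 2 (1 - Q) + 4 T`. -/
theorem hayashi_nagaoka {Q T : Matrix d d ℂ} (hQ : Q.PosSemidef) (hQ1 : (1 - Q).PosSemidef)
    (hT : T.PosSemidef) :
    ((2 : ℂ) • (1 - Q) + (4 : ℂ) • T - (1 - invSqrt (Q + T) * Q * invSqrt (Q + T))).PosSemidef := by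
  obtain ⟨L, hL, hLL, hRS, hSR⟩ := exists_sqrt_invSqrt (hQ.add hT)
  have hproj := posSemidef_one_sub_invSqrt (hQ.add hT)
  have hR := invSqrt_isHermitian (Q + T)
  set R := invSqrt (Q + T) with hRdef
  -- Q - Q² = Q(1-Q)Q + (1-Q)Q(1-Q).
  have hQQ : (Q - Q * Q).PosSemidef := by
    have h1 := hQ1.conjTranspose_mul_mul_same Q
    have h2 := hQ.conjTranspose_mul_mul_same (1 - Q)
    rw [hQ.isHermitian.eq] at h1
    rw [hQ1.isHermitian.eq] at h2
    convert h1.add h2 using 1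
    noncomm_ring
  -- L² = Q + T ≥ Q ≥ Q².
  have hLQ : (L - Q).PosSemidef := by
    refine posSemidef_sub_of_mul_self_le hL hQ ?_
    rw [hLL]
    convert hT.add hQQ using 1
    abel
  have hR1 : (R - 1).IsHermitian := hR.sub Matrix.isHermitian_one
  have hR2 : (R - 2).IsHermitian := by
    convert hR1.sub Matrix.isHermitian_one using 1
    rw [sub_sub, one_add_one_eq_two]
  have h1 := hT.conjTranspose_mul_mul_same (R - 2)
  have h2 := hQ.conjTranspose_mul_mul_same (R - 1)
  rw [hR2.eq] at h1
  rw [hR1.eq] at h2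
  -- With S = Q + T, R = S^{-1/2} and L = S^{1/2}, the difference of the two sides is (1 - RSR) +
  -- 4(L - Q) + 2(R-1)Q(R-1) + (R-2)T(R-2). The cross terms cancel because RS = SR = L.
  have key := ((hproj.add (hLQ.smul (show (0 : ℝ) ≤ 4 by norm_num))).add
    (h2.smul (show (0 : ℝ) ≤ 2 by norm_num))).add h1
  convert key using 1
  have e1 : R * Q + R * T - L = 0 := by rw [← hRS]; noncomm_ring
  have e2 : Q * R + T * R - L = 0 := by rw [← hSR]; noncomm_ring
  have s2 : ∀ M : Matrix d d ℂ, (2 : ℂ) • M = M + M := fun M => two_smul ℂ M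
  have s2' : ∀ M : Matrix d d ℂ, (2 : ℝ) • M = M + M := fun M => two_smul ℝ M
  have s4 : ∀ M : Matrix d d ℂ, (4 : ℂ) • M = M + M + (M + M) := fun M => by
    rw [← two_smul ℂ M, ← two_smul ℂ, smul_smul]; norm_num
  have s4' : ∀ M : Matrix d d ℂ, (4 : ℝ) • M = M + M + (M + M) := fun M => by
    rw [← two_smul ℝ M, ← two_smul ℝ, smul_smul]; norm_num
  rw [s2, s2', s4, s4', ← sub_eq_zero]
  have e3 : (R * Q + R * T - L) + (R * Q + R * T - L) + (Q * R + T * R - L)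
      + (Q * R + T * R - L) = 0 := by rw [e1, e2]; simp
  rw [← e3]
  noncomm_ring

theorem hayashi_nagaoka_trace {Q T σ : Matrix d d ℂ} (hQ : Q.PosSemidef)
    (hQ1 : (1 - Q).PosSemidef) (hT : T.PosSemidef) (hσ : σ.PosSemidef) :
    ((1 - invSqrt (Q + T) * Q * invSqrt (Q + T)) * σ).trace.re ≤
      2 * ((1 - Q) * σ).trace.re + 4 * (T * σ).trace.re := by
  have h := trace_mul_re_nonneg (hayashi_nagaoka hQ hQ1 hT) hσ
  simp only [Matrix.sub_mul, Matrix.add_mul, Matrix.smul_mul, Matrix.trace_sub, Matrix.trace_add,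
    Matrix.trace_smul, Complex.sub_re, Complex.add_re, smul_eq_mul, Complex.mul_re,
    Complex.re_ofNat, Complex.im_ofNat, zero_mul, sub_zero] at h ⊢
  linarith

end Matrices

/-! ### Random codebooks -/

section Codebooks
variable {K : ℕ} {Y : Fin K → Type u} [∀ k, Fintype (Y k)] [∀ k, DecidableEq (Y k)]

/-- The joint distribution of two tuples that are independent in the coordinates of `J` and
agree in the others. -/
def pairWeight (w : ∀ k, Y k → ℝ) (J : Finset (Fin K)) (u v : ∀ k, Y k) : ℝ :=
  ∏ k, if k ∈ J then w k (u k) * w k (v k) else if u k = v k then w k (u k) else 0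

theorem pairWeight_nonneg {w : ∀ k, Y k → ℝ} (hw : ∀ k y, 0 ≤ w k y) (J : Finset (Fin K))
    (u v : ∀ k, Y k) : 0 ≤ pairWeight w J u v := by
  refine Finset.prod_nonneg fun k _ => ?_
  split_ifs
  · exact mul_nonneg (hw _ _) (hw _ _)
  · exact hw _ _
  · exact le_rfl

/-- Joint law of two codewords of one sender: independent for distinct messages, identical for equal
ones. The indicators are absorbed into the factors at a and b, so that the sum over codebooks
factorises. -/
theorem sum_prod_mul_indicator {Z : Type u} [Fintype Z] [DecidableEq Z] {w : Z → ℝ}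
    (hw : ∑ y, w y = 1) {M : ℕ} (a b : Fin M) (u v : Z) :
    ∑ x : Fin M → Z, (∏ j, w (x j)) * ((if x a = u then 1 else 0) * (if x b = v then 1 else 0)) =
      if a ≠ b then w u * w v else if u = v then w u else 0 := by
  have h1 : ∀ x : Fin M → Z,
      (∏ j, w (x j)) * ((if x a = u then 1 else 0) * (if x b = v then 1 else 0)) =
        ∏ j, (w (x j) * ((if j = a then (if x j = u then 1 else 0) else 1) *
          (if j = b then (if x j = v then 1 else 0) else 1))) := by
    intro x
    rw [Finset.prod_mul_distrib, Finset.prod_mul_distrib, Finset.prod_ite_eq', Finset.prod_ite_eq']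
    simp
  rw [Finset.sum_congr rfl fun x _ => h1 x]
  have h2 := Finset.prod_univ_sum (fun _ : Fin M => (Finset.univ : Finset Z)) (fun j y =>
    w y * ((if j = a then (if y = u then (1 : ℝ) else 0) else 1) *
          (if j = b then (if y = v then 1 else 0) else 1)))
  rw [Fintype.piFinset_univ] at h2
  rw [← h2]
  split_ifs with hab huv
  · have h3 : ∀ j : Fin M, ∑ y, w y * ((if j = a then (if y = u then (1 : ℝ) else 0) else 1) *
          (if j = b then (if y = v then 1 else 0) else 1)) =
        (if j = a then w u else 1) * (if j = b then w v else 1) := by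
      intro j
      by_cases hja : j = a
      · have : j ≠ b := fun h => hab (hja.symm.trans h)
        simp [hja, hab]
      · by_cases hjb : j = b
        · simp [hjb, Ne.symm hab]
        · simp [hja, hjb, hw]
    rw [Finset.prod_congr rfl fun j _ => h3 j, Finset.prod_mul_distrib, Finset.prod_ite_eq',
      Finset.prod_ite_eq']
    simp
  · have hab := not_not.1 hab
    subst hab huv
    have h3 : ∀ j : Fin M, ∑ y, w y * ((if j = a then (if y = u then (1 : ℝ) else 0) else 1) *
          (if j = a then (if y = u then 1 else 0) else 1)) = if j = a then w u else 1 := by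
      intro j
      by_cases hja : j = a
      · simp [hja]
      · simp [hja, hw]
    rw [Finset.prod_congr rfl fun j _ => h3 j, Finset.prod_ite_eq']
    simp
  · have hab := not_not.1 hab
    subst hab
    refine Finset.prod_eq_zero (Finset.mem_univ a) (Finset.sum_eq_zero fun y _ => ?_)
    by_cases hy : y = u
    · simp [hy, huv]
    · simp [hy]

/-- Expanding F in indicators of the two selected tuples makes the expectation factorise over
senders, each of which contributes the law of one pair of codewords. -/
theorem sum_codebook_pair {w : ∀ k, Y k → ℝ} (hw : ∀ k, ∑ y, w k y = 1) {M : Fin K → ℕ}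
    (a b : ∀ k, Fin (M k)) (F : (∀ k, Y k) → (∀ k, Y k) → ℝ) :
    ∑ x : ∀ k, Fin (M k) → Y k, (∏ k, ∏ j, w k (x k j)) *
        F (fun k => x k (a k)) (fun k => x k (b k)) =
      ∑ u, ∑ v, pairWeight w (Finset.univ.filter fun k => a k ≠ b k) u v * F u v := by
  have h1 : ∀ x : ∀ k, Fin (M k) → Y k, F (fun k => x k (a k)) (fun k => x k (b k)) =
      ∑ u, ∑ v, (∏ k, ((if x k (a k) = u k then 1 else 0) * (if x k (b k) = v k then 1 else 0)))
        * F u v := by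
    intro x
    have h2 : ∀ u v : ∀ k, Y k,
        (∏ k, ((if x k (a k) = u k then (1 : ℝ) else 0) * (if x k (b k) = v k then 1 else 0))) =
        (if (fun k => x k (a k)) = u then 1 else 0) *
          (if (fun k => x k (b k)) = v then 1 else 0) := by
      intro u v
      rw [Finset.prod_mul_distrib, Finset.prod_ite_zero, Finset.prod_ite_zero]
      simp [funext_iff]
    simp_rw [h2]
    simp
  simp_rw [h1, Finset.mul_sum]
  rw [Finset.sum_comm]
  refine Finset.sum_congr rfl fun u _ => ?_
  rw [Finset.sum_comm]
  refine Finset.sum_congr rfl fun v _ => ?_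
  simp_rw [← mul_assoc, ← Finset.prod_mul_distrib]
  rw [← Finset.sum_mul]
  congr 1
  have h3 := Finset.prod_univ_sum (fun k : Fin K => (Finset.univ : Finset (Fin (M k) → Y k)))
    (fun k x => (∏ j, w k (x j)) *
      ((if x (a k) = u k then 1 else 0) * (if x (b k) = v k then 1 else 0)))
  rw [Fintype.piFinset_univ] at h3
  rw [← h3, pairWeight]
  refine Finset.prod_congr rfl fun k _ => ?_
  rw [sum_prod_mul_indicator (hw k)]
  simp

theorem sum_prod_eq_one {w : ∀ k, Y k → ℝ} (hw : ∀ k, ∑ y, w k y = 1) :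
    ∑ u : ∀ k, Y k, ∏ k, w k (u k) = 1 := by
  have h := Finset.prod_univ_sum (fun k : Fin K => (Finset.univ : Finset (Y k))) w
  rw [Fintype.piFinset_univ] at h
  rw [← h]
  simp [hw]

theorem sum_codebook_single {w : ∀ k, Y k → ℝ} (hw : ∀ k, ∑ y, w k y = 1) {M : Fin K → ℕ}
    (a : ∀ k, Fin (M k)) (F : (∀ k, Y k) → ℝ) :
    ∑ x : ∀ k, Fin (M k) → Y k, (∏ k, ∏ j, w k (x k j)) * F (fun k => x k (a k)) =
      ∑ u, (∏ k, w k (u k)) * F u := by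
  rw [sum_codebook_pair hw a a (fun u _ => F u)]
  refine Finset.sum_congr rfl fun u _ => ?_
  have h : ∀ v, pairWeight w (Finset.univ.filter fun k => a k ≠ a k) u v * F u =
      if u = v then (∏ k, w k (u k)) * F u else 0 := by
    intro v
    simp only [pairWeight, ne_eq, not_true_eq_false, Finset.filter_false, Finset.notMem_empty,
      if_false]
    rw [Finset.prod_ite_zero]
    simp [funext_iff]
  rw [Finset.sum_congr rfl fun v _ => h v]
  simp

theorem card_filter_ne_eq {M : Fin K → ℕ} (m : ∀ k, Fin (M k)) (J : Finset (Fin K)) :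
    (Finset.univ.filter fun m' : ∀ k, Fin (M k) =>
      (Finset.univ.filter fun k => m' k ≠ m k) = J).card = ∏ k ∈ J, (M k - 1) := by
  have h : (Finset.univ.filter fun m' : ∀ k, Fin (M k) =>
      (Finset.univ.filter fun k => m' k ≠ m k) = J) =
      Fintype.piFinset fun k => if k ∈ J then Finset.univ.erase (m k) else {m k} := by
    ext m'
    simp only [Finset.mem_filter, Finset.mem_univ, true_and, Fintype.mem_piFinset,
      Finset.ext_iff]
    refine forall_congr' fun k => ?_
    by_cases hk : k ∈ J <;> simp [hk]
  rw [h, Fintype.card_piFinset, ← Finset.prod_filter_mul_prod_filter_not _ (fun k => k ∈ J)]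
  rw [Finset.filter_mem_eq_inter, Finset.univ_inter]
  have h2 : ∏ x ∈ Finset.univ.filter (fun k => k ∉ J),
      (if x ∈ J then Finset.univ.erase (m x) else {m x}).card = 1 :=
    Finset.prod_eq_one fun k hk => by simp [(Finset.mem_filter.1 hk).2]
  rw [h2, mul_one]
  exact Finset.prod_congr rfl fun k hk => by simp [hk]

/-- Sorts the wrong message tuples by the senders that differ. This set is nonempty since m' ≠ m,
and each sender in it has `M k - 1` alternatives. -/
theorem sum_erase_differing {M : Fin K → ℕ} (m : ∀ k, Fin (M k)) (f : Finset (Fin K) → ℝ) :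
    ∑ m' ∈ Finset.univ.erase m, f (Finset.univ.filter fun k => m' k ≠ m k) =
      ∑ J ∈ Finset.univ.filter (fun J : Finset (Fin K) => J.Nonempty),
        (∏ k ∈ J, ((M k - 1 : ℕ) : ℝ)) * f J := by
  have hmaps : ∀ m' ∈ Finset.univ.erase m, (Finset.univ.filter fun k => m' k ≠ m k) ∈
      Finset.univ.filter (fun J : Finset (Fin K) => J.Nonempty) := by
    intro m' hm'
    obtain ⟨k, hk⟩ := Function.ne_iff.1 (Finset.ne_of_mem_erase hm')
    simpa using ⟨k, by simpa using hk⟩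
  rw [← Finset.sum_fiberwise_of_maps_to hmaps]
  refine Finset.sum_congr rfl fun J hJ => ?_
  have hJ' : J.Nonempty := (Finset.mem_filter.1 hJ).2
  have h1 : (Finset.univ.erase m).filter
      (fun m' => (Finset.univ.filter fun k => m' k ≠ m k) = J) =
      Finset.univ.filter fun m' : ∀ k, Fin (M k) =>
        (Finset.univ.filter fun k => m' k ≠ m k) = J := by
    ext m'
    simp only [Finset.mem_filter, Finset.mem_erase, Finset.mem_univ, and_true, true_and,
      and_iff_right_iff_imp]
    rintro h rfl
    simp at h
    exact hJ'.ne_empty h.symm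
  rw [h1, Finset.sum_congr rfl fun m' hm' => congrArg f (Finset.mem_filter.1 hm').2,
    Finset.sum_const, card_filter_ne_eq, nsmul_eq_mul]
  push_cast
  rfl

end Codebooks

/-! ### Expected error of a simultaneous decoder -/

section OneShot
variable {K : ℕ} {X : Fin K → Type u} [∀ k, Fintype (X k)] [∀ k, DecidableEq (X k)]
  {d : Type v} [Fintype d] [DecidableEq d]

/-- The probability of a word with independent letters drawn from `p k`. -/
def wordProb (p : ∀ k, X k → ℝ) (n : ℕ) (k : Fin K) (y : Fin n → X k) : ℝ := ∏ i, p k (y i)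

theorem sum_wordProb {p : ∀ k, X k → ℝ} (hp : ∀ k, p k ∈ stdSimplex ℝ (X k)) (n : ℕ) (k : Fin K) :
    ∑ y, wordProb p n k y = 1 := by
  simp only [wordProb]
  rw [← Fintype.sum_pow, (hp k).2, one_pow]

theorem avgError_code_le {ρ : (∀ k, X k) → Matrix d d ℂ} {n : ℕ}
    (hσ : ∀ u : ∀ k, Fin n → X k, (channelOutput ρ u).PosSemidef) {M : Fin K → ℕ}
    (D : SimultaneousDecoder X d n) (x : Codebook X n M) :
    (D.code x).avgError ρ ≤ (∏ k, (M k : ℝ))⁻¹ * ∑ m : ∀ k, Fin (M k),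
      (2 * ((1 - D.test fun k => x k (m k)) * channelOutput ρ fun k => x k (m k)).trace.re +
        4 * ∑ m' ∈ Finset.univ.erase m,
          ((D.test fun k => x k (m' k)) * channelOutput ρ fun k => x k (m k)).trace.re) := by
  refine mul_le_mul_of_nonneg_left (Finset.sum_le_sum fun m _ => ?_)
    (inv_nonneg.2 (Finset.prod_nonneg fun k _ => Nat.cast_nonneg _))
  have hsum : ∑ j : ∀ k, Fin (M k), D.test (fun k => x k (j k)) =
      D.test (fun k => x k (m k)) + ∑ j ∈ Finset.univ.erase m, D.test (fun k => x k (j k)) :=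
    (Finset.add_sum_erase _ _ (Finset.mem_univ m)).symm
  have h := hayashi_nagaoka_trace (D.test_nonneg fun k => x k (m k)) (D.test_le_one _)
    (Matrix.posSemidef_sum (Finset.univ.erase m) fun j _ => D.test_nonneg fun k => x k (j k))
    (hσ fun k => x k (m k))
  rw [← hsum, Finset.sum_mul, Matrix.trace_sum, Complex.re_sum] at h
  exact h

/-- After averaging over codebooks the bound is the same for every sent tuple m, so the average over
messages drops out. In the pair sum, u are the wrong words being tested and v the words actually
sent. -/
theorem expected_avgError_le {p : ∀ k, X k → ℝ} (hp : ∀ k, p k ∈ stdSimplex ℝ (X k))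
    {ρ : (∀ k, X k) → Matrix d d ℂ} {n : ℕ}
    (hσ : ∀ u : ∀ k, Fin n → X k, (channelOutput ρ u).PosSemidef) {M : Fin K → ℕ}
    (hM : ∀ k, 0 < M k) (D : SimultaneousDecoder X d n) :
    ∑ x : Codebook X n M, codebookProb p x * (D.code x).avgError ρ ≤
      2 * ∑ u, (∏ k, wordProb p n k (u k)) * ((1 - D.test u) * channelOutput ρ u).trace.re +
      4 * ∑ J ∈ Finset.univ.filter (fun J : Finset (Fin K) => J.Nonempty),
        (∏ k ∈ J, ((M k - 1 : ℕ) : ℝ)) *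
          ∑ u, ∑ v, pairWeight (wordProb p n) J u v * (D.test u * channelOutput ρ v).trace.re := by
  have hw := sum_wordProb hp n
  have hP : ∀ x : Codebook X n M, codebookProb p x = ∏ k, ∏ m, wordProb p n k (x k m) :=
    fun x => rfl
  have hPnn : ∀ x : Codebook X n M, 0 ≤ codebookProb p x := fun x =>
    Finset.prod_nonneg fun k _ => Finset.prod_nonneg fun m _ => Finset.prod_nonneg fun i _ =>
      (hp k).1 _
  have hcard : (∏ k, (M k : ℝ)) ≠ 0 :=
    Finset.prod_ne_zero_iff.2 fun k _ => Nat.cast_ne_zero.2 (hM k).ne'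
  refine (Finset.sum_le_sum fun x _ => mul_le_mul_of_nonneg_left
    (avgError_code_le hσ D x) (hPnn x)).trans (le_of_eq ?_)
  have h1 : ∀ m : ∀ k, Fin (M k), ∑ x : Codebook X n M, codebookProb p x *
      (2 * ((1 - D.test fun k => x k (m k)) * channelOutput ρ fun k => x k (m k)).trace.re +
        4 * ∑ m' ∈ Finset.univ.erase m,
          ((D.test fun k => x k (m' k)) * channelOutput ρ fun k => x k (m k)).trace.re) =
      2 * ∑ u, (∏ k, wordProb p n k (u k)) * ((1 - D.test u) * channelOutput ρ u).trace.re +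
      4 * ∑ J ∈ Finset.univ.filter (fun J : Finset (Fin K) => J.Nonempty),
        (∏ k ∈ J, ((M k - 1 : ℕ) : ℝ)) *
          ∑ u, ∑ v, pairWeight (wordProb p n) J u v *
            (D.test u * channelOutput ρ v).trace.re := by
    intro m
    rw [← sum_erase_differing m (fun J => ∑ u, ∑ v, pairWeight (wordProb p n) J u v *
      (D.test u * channelOutput ρ v).trace.re),
      ← sum_codebook_single hw m (fun u => ((1 - D.test u) * channelOutput ρ u).trace.re)]
    simp_rw [← sum_codebook_pair hw _ m (fun u v => (D.test u * channelOutput ρ v).trace.re)]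
    rw [Finset.sum_comm, Finset.mul_sum, Finset.mul_sum, ← Finset.sum_add_distrib]
    refine Finset.sum_congr rfl fun x _ => ?_
    rw [hP x, ← Finset.mul_sum]
    ring
  calc _ = (∏ k, (M k : ℝ))⁻¹ * ∑ m : ∀ k, Fin (M k), ∑ x : Codebook X n M, codebookProb p x *
      (2 * ((1 - D.test fun k => x k (m k)) * channelOutput ρ fun k => x k (m k)).trace.re +
        4 * ∑ m' ∈ Finset.univ.erase m,
          ((D.test fun k => x k (m' k)) * channelOutput ρ fun k => x k (m k)).trace.re) := by
        rw [Finset.sum_comm, Finset.mul_sum]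
        refine Finset.sum_congr rfl fun x _ => ?_
        rw [← Finset.mul_sum]
        ring
    _ = _ := by
        rw [Finset.sum_congr rfl fun m _ => h1 m, Finset.sum_const, Finset.card_univ,
          Fintype.card_pi, nsmul_eq_mul]
        simp only [Fintype.card_fin]
        push_cast
        rw [← mul_assoc, inv_mul_cancel₀ hcard, one_mul]

theorem exists_avgError_le {p : ∀ k, X k → ℝ} (hp : ∀ k, p k ∈ stdSimplex ℝ (X k))
    {n : ℕ} {M : Fin K → ℕ} {f : Codebook X n M → ℝ} {ε : ℝ}
    (h : ∑ x, codebookProb p x * f x ≤ ε) : ∃ x, f x ≤ ε := by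
  have hPnn : ∀ x : Codebook X n M, 0 ≤ codebookProb p x := fun x =>
    Finset.prod_nonneg fun k _ => Finset.prod_nonneg fun m _ => Finset.prod_nonneg fun i _ =>
      (hp k).1 _
  have hsum : ∑ x : Codebook X n M, codebookProb p x = 1 := by
    refine sum_prod_eq_one (Y := fun k => Fin (M k) → Fin n → X k)
      (w := fun k x => ∏ m, wordProb p n k (x m)) fun k => ?_
    rw [← Fintype.sum_pow, sum_wordProb hp, one_pow]
  by_contra! hcon
  obtain ⟨x, hx⟩ : ∃ x : Codebook X n M, 0 < codebookProb p x := by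
    by_contra! h0
    have := Finset.sum_nonpos fun x (_ : x ∈ Finset.univ) => h0 x
    linarith
  have : ∑ x : Codebook X n M, codebookProb p x * ε < ∑ x, codebookProb p x * f x :=
    Finset.sum_lt_sum (fun x _ => mul_le_mul_of_nonneg_left (hcon x).le (hPnn x))
      ⟨x, Finset.mem_univ x, mul_lt_mul_of_pos_left (hcon x) hx⟩
  rw [← Finset.sum_mul, hsum, one_mul] at this
  linarith

end OneShot

/-! ### Tensor products of matrices -/

section Tensor
variable {d : Type v} [Fintype d] {n : ℕ}

theorem tensor_mul (A B : Fin n → Matrix d d ℂ) :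
    tensor A * tensor B = tensor fun i => A i * B i := by
  classical
  ext a b
  simp only [tensor, Matrix.mul_apply, Matrix.of_apply]
  rw [Finset.prod_univ_sum, Fintype.piFinset_univ]
  exact Finset.sum_congr rfl fun c _ => Finset.prod_mul_distrib.symm

theorem tensor_conjTranspose (A : Fin n → Matrix d d ℂ) :
    (tensor A).conjTranspose = tensor fun i => (A i).conjTranspose := by
  ext a b
  simp [tensor, Matrix.conjTranspose_apply]

theorem trace_tensor [DecidableEq d] (A : Fin n → Matrix d d ℂ) :
    (tensor A).trace = ∏ i, (A i).trace := by
  simp only [tensor, Matrix.trace, Matrix.diag_apply, Matrix.of_apply]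
  rw [Finset.prod_univ_sum, Fintype.piFinset_univ]

theorem tensor_diagonal [DecidableEq d] (f : Fin n → d → ℂ) :
    tensor (fun i => Matrix.diagonal (f i)) = Matrix.diagonal fun y => ∏ i, f i (y i) := by
  ext a b
  simp only [tensor, Matrix.of_apply, Matrix.diagonal_apply]
  rw [Finset.prod_ite_zero]
  simp [funext_iff]

theorem tensor_one [DecidableEq d] : tensor (fun _ : Fin n => (1 : Matrix d d ℂ)) = 1 := by
  simp_rw [← Matrix.diagonal_one]
  rw [tensor_diagonal]
  simp

/-- Needed because the real part is multiplicative over channel uses only when the single-use traces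
are real. -/
theorem trace_mul_eq_ofReal {A B : Matrix d d ℂ} (hA : A.IsHermitian) (hB : B.IsHermitian) :
    (A * B).trace = (((A * B).trace.re : ℝ) : ℂ) := by
  have h : star (A * B).trace = (A * B).trace := by
    rw [← Matrix.trace_conjTranspose, Matrix.conjTranspose_mul, hA.eq, hB.eq,
      Matrix.trace_mul_comm]
  exact (Complex.conj_eq_iff_re.1 h).symm

end Tensor

/-! ### Classical form of the information quantities -/

section Entropies
variable {K : ℕ} {X : Fin K → Type u} [∀ k, Fintype (X k)] [∀ k, DecidableEq (X k)]
  {d : Type v} [Fintype d] [DecidableEq d]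

/-- The probability of the coordinates of `x` in `J`. -/
def subProb (p : ∀ k, X k → ℝ) (J : Finset (Fin K)) (x : ∀ k, X k) : ℝ := ∏ k ∈ J, p k (x k)

/-- The joint distribution of the input and the eigenvalue index of the output state. -/
def jointProb (p : ∀ k, X k → ℝ) (lam : (∀ k, X k) → d → ℝ) (z : (∀ k, X k) × d) : ℝ :=
  (∏ k, p k (z.1 k)) * lam z.1 z.2

theorem cqState_apply (p : ∀ k, X k → ℝ) (ρ : (∀ k, X k) → Matrix d d ℂ)
    (a b : (∀ k, X k) × d) :
    cqState p ρ a b = if a.1 = b.1 then ((∏ k, p k (a.1 k) : ℝ) : ℂ) * ρ a.1 a.2 b.2 else 0 := by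
  obtain ⟨x, c⟩ := a
  obtain ⟨y, c'⟩ := b
  have h : ∀ z : ∀ k, X k, (((∏ k, p k (z k) : ℝ) : ℂ) •
      Matrix.kronecker (Matrix.single z z (1 : ℂ)) (ρ z)) (x, c) (y, c') =
      if z = x then (if x = y then ((∏ k, p k (x k) : ℝ) : ℂ) * ρ x c c' else 0) else 0 := by
    intro z
    rw [Matrix.smul_apply, Matrix.kronecker, Matrix.kroneckerMap_apply, Matrix.single_apply]
    by_cases hzx : z = x
    · subst hzx
      by_cases hzy : z = y <;> simp [hzy]
    · simp [hzx]
  rw [cqState, Matrix.sum_apply, Finset.sum_congr rfl fun z _ => h z]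
  simp

theorem vonNeumannEntropy_cqState {p : ∀ k, X k → ℝ} {ρ U : (∀ k, X k) → Matrix d d ℂ}
    {lam : (∀ k, X k) → d → ℝ} (hU : ∀ x, U x ∈ Matrix.unitaryGroup d ℂ)
    (hρ : ∀ x, ρ x = U x * Matrix.diagonal (fun i => (lam x i : ℂ)) * star (U x)) :
    vonNeumannEntropy (cqState p ρ) =
      -∑ z, jointProb p lam z * Real.logb 2 (jointProb p lam z) := by
  -- The eigenbases of the ρ_x, placed in blocks labelled by x, diagonalise the whole state.
  set W : Matrix ((∀ k, X k) × d) ((∀ k, X k) × d) ℂ :=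
    Matrix.of fun a b => if a.1 = b.1 then U a.1 a.2 b.2 else 0 with hW
  have hWU : W ∈ Matrix.unitaryGroup ((∀ k, X k) × d) ℂ := by
    rw [Matrix.mem_unitaryGroup_iff]
    ext ⟨x, c⟩ ⟨y, c'⟩
    rw [Matrix.mul_apply, Fintype.sum_prod_type]
    have h := congrFun (congrFun ((Matrix.mem_unitaryGroup_iff).1 (hU x)) c) c'
    rw [Matrix.mul_apply] at h
    by_cases hxy : x = y
    · subst hxy
      rw [Finset.sum_eq_single x]
      · simpa [hW, Matrix.star_apply, Matrix.one_apply] using h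
      · intro z _ hz
        simp [hW, Ne.symm hz]
      · simp
    · simp [hW, Matrix.star_apply, hxy, Ne.symm hxy]
  have hdec : cqState p ρ = W * Matrix.diagonal (fun z => (jointProb p lam z : ℂ)) * star W := by
    ext ⟨x, c⟩ ⟨y, c'⟩
    rw [cqState_apply, Matrix.mul_apply, Fintype.sum_prod_type]
    have h := congrFun (congrFun (hρ x) c) c'
    rw [Matrix.mul_apply] at h
    simp only [Matrix.mul_diagonal] at h ⊢
    by_cases hxy : x = y
    · subst hxy
      simp only [Matrix.star_apply] at h
      simp only [if_true, h, hW, Matrix.star_apply, Matrix.of_apply, jointProb]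
      rw [Finset.sum_eq_single x]
      · simp only [if_true, Finset.mul_sum]
        refine Finset.sum_congr rfl fun i _ => ?_
        push_cast
        ring
      · intro z _ hz
        simp [Ne.symm hz]
      · simp
    · simp only [hxy, if_false, hW, Matrix.star_apply, Matrix.of_apply]
      symm
      refine Finset.sum_eq_zero fun z _ => Finset.sum_eq_zero fun i _ => ?_
      by_cases hz : x = z
      · subst hz
        simp [Ne.symm hxy]
      · simp [hz]
  rw [vonNeumannEntropy, hdec, trace_cfc_conj_diagonal hWU]

theorem sum_piSubtype (S : Finset (Fin K)) (f : (∀ k, X k) → ℝ) :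
    ∑ x, f x = ∑ a : (∀ k : {k // k ∈ S}, X k), ∑ z : (∀ k : {k // ¬ k ∈ S}, X k),
      f ((Equiv.piEquivPiSubtypeProd (fun k => k ∈ S) X).symm (a, z)) := by
  rw [← Fintype.sum_prod_type', ← Equiv.sum_comp (Equiv.piEquivPiSubtypeProd (fun k => k ∈ S) X).symm]

theorem prod_mem_mul_prod_notMem (S : Finset (Fin K)) (g : Fin K → ℝ) :
    (∏ k : {k // k ∈ S}, g k) * ∏ k : {k // ¬ k ∈ S}, g k = ∏ k, g k := by
  convert Fintype.prod_subtype_mul_prod_subtype (fun k => k ∈ S) g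

theorem prod_piSubtype (S : Finset (Fin K)) (f : ∀ k, X k → ℝ)
    (a : ∀ k : {k // k ∈ S}, X k) (z : ∀ k : {k // ¬ k ∈ S}, X k) :
    ∏ k, f k ((Equiv.piEquivPiSubtypeProd (fun k => k ∈ S) X).symm (a, z) k) =
      (∏ k : {k // k ∈ S}, f k (a k)) * ∏ k : {k // ¬ k ∈ S}, f k (z k) := by
  rw [← prod_mem_mul_prod_notMem S]
  congr 1
  · exact Finset.prod_congr rfl fun k _ => by simp [Equiv.piEquivPiSubtypeProd, k.2]
  · exact Finset.prod_congr rfl fun k _ => by simp [Equiv.piEquivPiSubtypeProd, k.2]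

theorem subProb_piSubtype (S : Finset (Fin K)) (p : ∀ k, X k → ℝ)
    (a : ∀ k : {k // k ∈ S}, X k) (z : ∀ k : {k // ¬ k ∈ S}, X k) :
    subProb p S ((Equiv.piEquivPiSubtypeProd (fun k => k ∈ S) X).symm (a, z)) =
      ∏ k : {k // k ∈ S}, p k (a k) := by
  rw [subProb, ← Finset.prod_coe_sort]
  exact Finset.prod_congr rfl fun k _ => by simp [Equiv.piEquivPiSubtypeProd, k.2]

theorem sum_prod_subtype_eq_one {p : ∀ k, X k → ℝ} (hp : ∀ k, p k ∈ stdSimplex ℝ (X k))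
    (P : Fin K → Prop) [DecidablePred P] :
    ∑ z : (∀ k : {k // P k}, X k), ∏ k : {k // P k}, p k (z k) = 1 := by
  have h := Finset.prod_univ_sum (fun k : {k // P k} => (Finset.univ : Finset (X k)))
    (fun k => p k)
  rw [Fintype.piFinset_univ] at h
  rw [← h]
  exact Finset.prod_eq_one fun k _ => (hp k).2

theorem marginalXC_cqState_apply (p : ∀ k, X k → ℝ) (ρ : (∀ k, X k) → Matrix d d ℂ)
    (S : Finset (Fin K)) (a b : (∀ k : {k // k ∈ S}, X k) × d) :
    marginalXC S (cqState p ρ) a b = if a.1 = b.1 then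
      (∑ z : (∀ k : {k // ¬ k ∈ S}, X k), ((((∏ k : {k // k ∈ S}, p k (a.1 k)) * ∏ k : {k // ¬ k ∈ S}, p k (z k) : ℝ)) : ℂ) •
        ρ ((Equiv.piEquivPiSubtypeProd (fun k => k ∈ S) X).symm (a.1, z))) a.2 b.2 else 0 := by
  simp only [marginalXC, Matrix.of_apply, cqState_apply, prod_piSubtype,
    EmbeddingLike.apply_eq_iff_eq, Prod.mk.injEq, and_true]
  split_ifs
  · simp [Matrix.sum_apply]
  · simp

theorem marginalX_cqState {p : ∀ k, X k → ℝ} (hp : ∀ k, p k ∈ stdSimplex ℝ (X k))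
    {ρ : (∀ k, X k) → Matrix d d ℂ} (hρ : ∀ x, (ρ x).trace = 1) (S : Finset (Fin K)) :
    marginalX S (cqState p ρ) = Matrix.diagonal fun a => ((∏ k : {k // k ∈ S}, p k (a k) : ℝ) : ℂ) := by
  ext a b
  simp only [marginalX, Matrix.of_apply, marginalXC_cqState_apply, Matrix.diagonal_apply]
  split_ifs with hab
  · change Matrix.trace (∑ z : (∀ k : {k // ¬ k ∈ S}, X k),
      (((∏ k : {k // k ∈ S}, p k (a k)) * ∏ k : {k // ¬ k ∈ S}, p k (z k) : ℝ) : ℂ) •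
        ρ ((Equiv.piEquivPiSubtypeProd (fun k => k ∈ S) X).symm (a, z))) = _
    rw [Matrix.trace_sum]
    simp only [Matrix.trace_smul, hρ, smul_eq_mul, mul_one]
    rw [← Complex.ofReal_sum, ← Finset.mul_sum, sum_prod_subtype_eq_one hp, mul_one]
  · simp

/-- Written as an expectation over all inputs, not only those in S, so that it matches the exponent
in the Chernoff bound for `subProb p S`. -/
theorem vonNeumannEntropy_marginalX {p : ∀ k, X k → ℝ} (hp : ∀ k, p k ∈ stdSimplex ℝ (X k))
    {ρ : (∀ k, X k) → Matrix d d ℂ} (hρ : ∀ x, (ρ x).trace = 1) (S : Finset (Fin K)) :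
    vonNeumannEntropy (marginalX S (cqState p ρ)) =
      -∑ x, (∏ k, p k (x k)) * Real.logb 2 (subProb p S x) := by
  have h := trace_cfc_conj_diagonal (one_mem (Matrix.unitaryGroup (∀ k : {k // k ∈ S}, X k) ℂ))
    (fun a => ∏ k : {k // k ∈ S}, p k (a k)) (fun t : ℝ => t * Real.logb 2 t)
  rw [star_one, mul_one, one_mul] at h
  rw [vonNeumannEntropy, marginalX_cqState hp hρ, h, sum_piSubtype S]
  congr 1
  refine Finset.sum_congr rfl fun a _ => ?_
  simp only [prod_piSubtype, subProb_piSubtype]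
  rw [← Finset.sum_mul, ← Finset.mul_sum, sum_prod_subtype_eq_one hp, mul_one]

/-- The reduced state is block diagonal in the value a of X(Jᶜ), with blocks ∑_z p(a)p(z)ρ_{a,z}.
Squaring a block gives p(a)² and two independent copies z, z' of X(J): one factor p(a) belongs to
`pairWeight`, the other is `subProb p Jᶜ`. -/
theorem purity_marginalXC (p : ∀ k, X k → ℝ) (ρ : (∀ k, X k) → Matrix d d ℂ)
    (J : Finset (Fin K)) :
    (marginalXC Jᶜ (cqState p ρ) * marginalXC Jᶜ (cqState p ρ)).trace.re =
      ∑ x, ∑ y, pairWeight p J x y * subProb p Jᶜ x * (ρ x * ρ y).trace.re := by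
  set e := Equiv.piEquivPiSubtypeProd (fun k => k ∈ Jᶜ) X with he
  have hpair : ∀ (a b : ∀ k : {k // k ∈ Jᶜ}, X k) (z z' : ∀ k : {k // ¬ k ∈ Jᶜ}, X k),
      pairWeight p J (e.symm (a, z)) (e.symm (b, z')) =
        if a = b then (∏ k : {k // k ∈ Jᶜ}, p k (a k)) * ((∏ k : {k // ¬ k ∈ Jᶜ}, p k (z k)) * ∏ k : {k // ¬ k ∈ Jᶜ}, p k (z' k)) else 0 := by
    intro a b z z'
    rw [pairWeight, ← prod_mem_mul_prod_notMem Jᶜ]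
    have h1 : ∀ k : {k // k ∈ Jᶜ}, (if (k : Fin K) ∈ J then
        p k (e.symm (a, z) k) * p k (e.symm (b, z') k) else
        if e.symm (a, z) k = e.symm (b, z') k then p k (e.symm (a, z) k) else 0) =
        if a k = b k then p k (a k) else 0 := by
      intro k
      have hk := k.2
      have hk' : (k : Fin K) ∉ J := Finset.mem_compl.1 hk
      simp [he, Equiv.piEquivPiSubtypeProd, hk']
    have h2 : ∀ k : {k // ¬ k ∈ Jᶜ}, (if (k : Fin K) ∈ J then
        p k (e.symm (a, z) k) * p k (e.symm (b, z') k) else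
        if e.symm (a, z) k = e.symm (b, z') k then p k (e.symm (a, z) k) else 0) =
        p k (z k) * p k (z' k) := by
      intro k
      have hk' : (k : Fin K) ∈ J := by simpa using k.2
      simp [he, Equiv.piEquivPiSubtypeProd, hk']
    rw [Finset.prod_congr rfl fun k _ => h1 k, Finset.prod_congr rfl fun k _ => h2 k,
      Finset.prod_ite_zero, Finset.prod_mul_distrib]
    simp [funext_iff]
  rw [sum_piSubtype Jᶜ]
  simp_rw [sum_piSubtype Jᶜ (fun y => pairWeight p J _ y * _ * _)]
  simp_rw [← he, hpair]
  rw [he]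
  simp_rw [subProb_piSubtype]
  rw [← he, Matrix.trace, Complex.re_sum, Fintype.sum_prod_type]
  refine Finset.sum_congr rfl fun a _ => ?_
  set B : Matrix d d ℂ := ∑ z : (∀ k : {k // ¬ k ∈ Jᶜ}, X k),
    ((((∏ k : {k // k ∈ Jᶜ}, p k (a k)) * ∏ k : {k // ¬ k ∈ Jᶜ}, p k (z k) : ℝ)) : ℂ) • ρ (e.symm (a, z)) with hB
  have h1 : ∑ c, ((marginalXC Jᶜ (cqState p ρ) * marginalXC Jᶜ (cqState p ρ)).diag (a, c)).re =
      (B * B).trace.re := by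
    rw [Matrix.trace, Complex.re_sum]
    refine Finset.sum_congr rfl fun c _ => ?_
    congr 1
    rw [Matrix.diag_apply, Matrix.diag_apply, Matrix.mul_apply, Matrix.mul_apply,
      Fintype.sum_prod_type, Finset.sum_eq_single a]
    · refine Finset.sum_congr rfl fun c' _ => ?_
      simp [marginalXC_cqState_apply, hB, he]
    · intro b _ hb
      refine Finset.sum_eq_zero fun c' _ => ?_
      simp [marginalXC_cqState_apply, Ne.symm hb]
    · simp
  rw [h1, hB, Finset.sum_mul, Matrix.trace_sum, Complex.re_sum]
  refine Finset.sum_congr rfl fun z _ => ?_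
  rw [Finset.mul_sum, Matrix.trace_sum, Complex.re_sum, Finset.sum_eq_single a]
  · refine Finset.sum_congr rfl fun z' _ => ?_
    rw [Matrix.smul_mul, Matrix.mul_smul, Matrix.trace_smul, Matrix.trace_smul, smul_eq_mul,
      smul_eq_mul, Complex.re_ofReal_mul, Complex.re_ofReal_mul, if_pos rfl]
    ring
  · intro b _ hb
    simp [Ne.symm hb]
  · simp

end Entropies

/-! ### Typical test operators -/

section Tests
variable {K : ℕ} {X : Fin K → Type u} [∀ k, Fintype (X k)] [∀ k, DecidableEq (X k)]
  {d : Type v} [Fintype d] [DecidableEq d]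

/-- The input letters of all senders in the `i`-th channel use. -/
def letters {n : ℕ} (u : ∀ k, Fin n → X k) (i : Fin n) : ∀ k, X k := fun k => u k i

theorem sum_letters {n : ℕ} (f : (Fin n → ∀ k, X k) → ℝ) :
    ∑ u : ∀ k, Fin n → X k, f (letters u) = ∑ z, f z :=
  Equiv.sum_comp (Equiv.piComm fun (k : Fin K) (_ : Fin n) => X k) f

theorem subProb_wordProb (p : ∀ k, X k → ℝ) {n : ℕ} (J : Finset (Fin K))
    (u : ∀ k, Fin n → X k) :
    subProb (wordProb p n) J u = ∏ i, subProb p J (letters u i) :=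
  Finset.prod_comm

theorem prod_wordProb (p : ∀ k, X k → ℝ) {n : ℕ} (u : ∀ k, Fin n → X k) :
    ∏ k, wordProb p n k (u k) = ∏ i, ∏ k, p k (letters u i k) :=
  Finset.prod_comm

theorem subProb_mul_compl (p : ∀ k, X k → ℝ) (J : Finset (Fin K)) (x : ∀ k, X k) :
    subProb p J x * subProb p Jᶜ x = ∏ k, p k (x k) :=
  Finset.prod_mul_prod_compl _ _

theorem subProb_nonneg {p : ∀ k, X k → ℝ} (hp : ∀ k x, 0 ≤ p k x) (J : Finset (Fin K))
    (x : ∀ k, X k) : 0 ≤ subProb p J x :=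
  Finset.prod_nonneg fun _ _ => hp _ _

theorem pairWeight_wordProb (p : ∀ k, X k → ℝ) {n : ℕ} (J : Finset (Fin K))
    (u v : ∀ k, Fin n → X k) :
    pairWeight (wordProb p n) J u v = ∏ i, pairWeight p J (letters u i) (letters v i) := by
  simp only [pairWeight]
  rw [Finset.prod_comm]
  refine Finset.prod_congr rfl fun k _ => ?_
  by_cases hk : k ∈ J
  · simp only [hk, if_true, wordProb, letters, Finset.prod_mul_distrib]
  · simp only [hk, if_false]
    change (if u k = v k then ∏ i, p k (u k i) else 0) =
      ∏ i, if u k i = v k i then p k (u k i) else 0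
    rw [Finset.prod_ite_zero]
    simp [funext_iff]

/-- Weights and traces are products over channel uses, so the sum over pairs of words is a power of
the single-letter sum. -/
theorem sum_pairWeight_purity (p : ∀ k, X k → ℝ) {ρ : (∀ k, X k) → Matrix d d ℂ}
    (hρ : ∀ x, (ρ x).IsHermitian) (n : ℕ) (J : Finset (Fin K)) :
    ∑ u, ∑ v, pairWeight (wordProb p n) J u v * subProb (wordProb p n) Jᶜ u *
        (channelOutput ρ u * channelOutput ρ v).trace.re =
      (∑ x, ∑ y, pairWeight p J x y * subProb p Jᶜ x * (ρ x * ρ y).trace.re) ^ n := by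
  have h1 : ∀ u v : ∀ k, Fin n → X k,
      pairWeight (wordProb p n) J u v * subProb (wordProb p n) Jᶜ u *
        (channelOutput ρ u * channelOutput ρ v).trace.re =
      ∏ i, (pairWeight p J (letters u i) (letters v i) * subProb p Jᶜ (letters u i) *
        (ρ (letters u i) * ρ (letters v i)).trace.re) := by
    intro u v
    rw [Finset.prod_mul_distrib, Finset.prod_mul_distrib, pairWeight_wordProb, subProb_wordProb]
    congr 1
    rw [channelOutput, channelOutput, tensor_mul, trace_tensor,
      ← Complex.ofReal_re (∏ i, (ρ (letters u i) * ρ (letters v i)).trace.re), Complex.ofReal_prod]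
    congr 1
    exact Finset.prod_congr rfl fun i _ => trace_mul_eq_ofReal (hρ _) (hρ _)
  simp_rw [h1]
  rw [sum_letters (fun a => ∑ v, ∏ i, (pairWeight p J (a i) (letters v i) * subProb p Jᶜ (a i) *
        (ρ (a i) * ρ (letters v i)).trace.re))]
  have h2 : ∀ a : Fin n → ∀ k, X k,
      ∑ v, ∏ i, (pairWeight p J (a i) (letters v i) * subProb p Jᶜ (a i) *
        (ρ (a i) * ρ (letters v i)).trace.re) =
      ∑ b : Fin n → ∀ k, X k, ∏ i, (pairWeight p J (a i) (b i) * subProb p Jᶜ (a i) *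
        (ρ (a i) * ρ (b i)).trace.re) := fun a =>
    sum_letters (fun b => ∏ i, (pairWeight p J (a i) (b i) * subProb p Jᶜ (a i) *
        (ρ (a i) * ρ (b i)).trace.re))
  simp_rw [h2]
  rw [← Fintype.sum_prod_type', ← Fintype.sum_prod_type', Fintype.sum_pow,
    ← Equiv.sum_comp (Equiv.arrowProdEquivProdArrow (Fin n) (fun _ => ∀ k, X k)
      (fun _ => ∀ k, X k))]
  rfl

variable {U : (∀ k, X k) → Matrix d d ℂ} {lam : (∀ k, X k) → d → ℝ}
  {ρ : (∀ k, X k) → Matrix d d ℂ}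

/-- The product eigenbasis of the output state on the input words `u`. -/
def wordBasis (U : (∀ k, X k) → Matrix d d ℂ) {n : ℕ} (u : ∀ k, Fin n → X k) :
    Matrix (Fin n → d) (Fin n → d) ℂ :=
  tensor fun i => U (letters u i)

theorem wordBasis_conjTranspose_mul (hU : ∀ x, U x ∈ Matrix.unitaryGroup d ℂ) {n : ℕ}
    (u : ∀ k, Fin n → X k) : (wordBasis U u).conjTranspose * wordBasis U u = 1 := by
  rw [wordBasis, tensor_conjTranspose, tensor_mul, ← tensor_one]
  congr 1
  funext i
  exact (Matrix.mem_unitaryGroup_iff').1 (hU _)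

theorem wordBasis_mul_conjTranspose (hU : ∀ x, U x ∈ Matrix.unitaryGroup d ℂ) {n : ℕ}
    (u : ∀ k, Fin n → X k) : wordBasis U u * (wordBasis U u).conjTranspose = 1 :=
  mul_eq_one_comm.1 (wordBasis_conjTranspose_mul hU u)

theorem channelOutput_eq
    (hρ : ∀ x, ρ x = U x * Matrix.diagonal (fun i => (lam x i : ℂ)) * star (U x)) {n : ℕ}
    (u : ∀ k, Fin n → X k) :
    channelOutput ρ u = wordBasis U u *
      Matrix.diagonal (fun y : Fin n → d => ((∏ i, lam (letters u i) (y i) : ℝ) : ℂ)) *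
        (wordBasis U u).conjTranspose := by
  have h : Matrix.diagonal (fun y : Fin n → d => ((∏ i, lam (letters u i) (y i) : ℝ) : ℂ)) =
      tensor fun i => Matrix.diagonal fun j => (lam (letters u i) j : ℂ) := by
    rw [tensor_diagonal]
    simp
  rw [h, wordBasis, tensor_conjTranspose, tensor_mul, tensor_mul, channelOutput]
  congr 1
  funext i
  exact hρ _

theorem posSemidef_conj_diagonal {m : Type v} [Fintype m] [DecidableEq m] (T : Matrix m m ℂ)
    {f : m → ℝ} (hf : ∀ y, 0 ≤ f y) :
    (T * Matrix.diagonal (fun y => (f y : ℂ)) * T.conjTranspose).PosSemidef :=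
  (Matrix.PosSemidef.diagonal fun y => by
    simpa using Complex.zero_le_real.2 (hf y)).mul_mul_conjTranspose_same T

/-- The decoder testing for the eigenvectors satisfying `c`. -/
noncomputable def eigenTest (hU : ∀ x, U x ∈ Matrix.unitaryGroup d ℂ) {n : ℕ}
    (c : (∀ k, Fin n → X k) → (Fin n → d) → Prop) [∀ u y, Decidable (c u y)] :
    SimultaneousDecoder X d n where
  test u := wordBasis U u *
    Matrix.diagonal (fun y => ((if c u y then 1 else 0 : ℝ) : ℂ)) * (wordBasis U u).conjTranspose
  test_nonneg u := posSemidef_conj_diagonal _ fun y => by split_ifs <;> norm_num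
  test_le_one u := by
    have h := posSemidef_conj_diagonal (wordBasis U u)
      (f := fun y => 1 - (if c u y then 1 else 0 : ℝ)) fun y => by split_ifs <;> norm_num
    convert h using 1
    simp only [Complex.ofReal_sub, Complex.ofReal_one]
    rw [← Matrix.diagonal_sub, Matrix.diagonal_one, Matrix.mul_sub, Matrix.sub_mul,
      Matrix.mul_one, wordBasis_mul_conjTranspose hU]

theorem trace_one_sub_eigenTest_mul (hU : ∀ x, U x ∈ Matrix.unitaryGroup d ℂ)
    (hρ : ∀ x, ρ x = U x * Matrix.diagonal (fun i => (lam x i : ℂ)) * star (U x)) {n : ℕ}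
    (c : (∀ k, Fin n → X k) → (Fin n → d) → Prop) [∀ u y, Decidable (c u y)]
    (u : ∀ k, Fin n → X k) :
    ((1 - (eigenTest hU c).test u) * channelOutput ρ u).trace.re =
      ∑ y : Fin n → d, if c u y then 0 else ∏ i, lam (letters u i) (y i) := by
  have hT := wordBasis_conjTranspose_mul hU u
  rw [channelOutput_eq hρ, eigenTest]
  set T := wordBasis U u
  set D := Matrix.diagonal (fun y => ((if c u y then 1 else 0 : ℝ) : ℂ)) with hD
  set L := Matrix.diagonal
    (fun y : Fin n → d => ((∏ i, lam (letters u i) (y i) : ℝ) : ℂ)) with hL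
  have h1 : (1 - T * D * T.conjTranspose) * (T * L * T.conjTranspose) =
      T * (L - D * L) * T.conjTranspose := by
    have : T * D * T.conjTranspose * (T * L * T.conjTranspose) =
        T * D * (T.conjTranspose * T) * L * T.conjTranspose := by noncomm_ring
    rw [Matrix.sub_mul, Matrix.one_mul, this, hT]
    noncomm_ring
  rw [h1, Matrix.mul_assoc, Matrix.trace_mul_comm, Matrix.mul_assoc, hT, Matrix.mul_one, hD, hL,
    Matrix.diagonal_mul_diagonal, Matrix.diagonal_sub, Matrix.trace_diagonal, Complex.re_sum]
  refine Finset.sum_congr rfl fun y _ => ?_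
  split_ifs
  · simp
  · simp only [Complex.ofReal_zero, zero_mul, sub_zero, Complex.ofReal_re]

/-- The test and the channel output are diagonal in the same basis, so comparing eigenvalues gives
the operator inequality Q^u ≤ t ρ_u, which is then traced against σ. -/
theorem trace_eigenTest_mul_le (hU : ∀ x, U x ∈ Matrix.unitaryGroup d ℂ)
    (hρ : ∀ x, ρ x = U x * Matrix.diagonal (fun i => (lam x i : ℂ)) * star (U x)) {n : ℕ}
    {c : (∀ k, Fin n → X k) → (Fin n → d) → Prop} [∀ u y, Decidable (c u y)]
    {u : ∀ k, Fin n → X k} {t : ℝ}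
    (ht : ∀ y, (if c u y then 1 else 0) ≤ t * ∏ i, lam (letters u i) (y i))
    {σ : Matrix (Fin n → d) (Fin n → d) ℂ} (hσ : σ.PosSemidef) :
    ((eigenTest hU c).test u * σ).trace.re ≤ t * (channelOutput ρ u * σ).trace.re := by
  have h := posSemidef_conj_diagonal (wordBasis U u)
    (f := fun y => t * ∏ i, lam (letters u i) (y i) - (if c u y then 1 else 0 : ℝ))
    fun y => sub_nonneg.2 (ht y)
  have h2 : wordBasis U u * Matrix.diagonal (fun y => ((t * ∏ i, lam (letters u i) (y i) -
      (if c u y then 1 else 0 : ℝ) : ℝ) : ℂ)) * (wordBasis U u).conjTranspose =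
      (t : ℂ) • channelOutput ρ u - (eigenTest hU c).test u := by
    rw [channelOutput_eq hρ, eigenTest]
    simp only [Complex.ofReal_sub, Complex.ofReal_mul]
    rw [← Matrix.diagonal_sub, Matrix.mul_sub, Matrix.sub_mul, ← Matrix.smul_mul,
      ← Matrix.mul_smul, ← Matrix.diagonal_smul]
    rfl
  rw [h2] at h
  have h3 := trace_mul_re_nonneg h hσ
  rw [Matrix.sub_mul, Matrix.smul_mul, Matrix.trace_sub, Matrix.trace_smul, Complex.sub_re,
    smul_eq_mul, Complex.re_ofReal_mul] at h3
  linarith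

end Tests

/-! ### Achievability -/

section Achievability
variable {K : ℕ} {X : Fin K → Type u} [∀ k, Fintype (X k)] [∀ k, DecidableEq (X k)]
  {d : Type v} [Fintype d] [DecidableEq d]
  {U : (∀ k, X k) → Matrix d d ℂ} {lam : (∀ k, X k) → d → ℝ}
  {ρ : (∀ k, X k) → Matrix d d ℂ} {p : ∀ k, X k → ℝ}

/-- The typicality condition: every marginal probability of the input words is at most `a J`,
and the joint probability of the input words and the eigenvector is at least `b`. -/
def IsTypical (p : ∀ k, X k → ℝ) (lam : (∀ k, X k) → d → ℝ) {n : ℕ}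
    (a : Finset (Fin K) → ℝ) (b : ℝ) (u : ∀ k, Fin n → X k) (y : Fin n → d) : Prop :=
  (∀ J, ∏ i, subProb p J (letters u i) ≤ a J) ∧ b ≤ ∏ i, jointProb p lam (letters u i, y i)

/-- On typical pairs b ≤ p_J(u) p_{Jᶜ}(u) λ_u(y) ≤ a_J p_{Jᶜ}(u) λ_u(y), hence Q^u ≤ a_J b⁻¹
p_{Jᶜ}(u) ρ_u. The factor p_{Jᶜ}(u) is kept rather than bounded: it is what turns the average into a
purity. The same test serves every J. -/
theorem sum_pairWeight_eigenTest_le (hU : ∀ x, U x ∈ Matrix.unitaryGroup d ℂ)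
    (hρ : ∀ x, ρ x = U x * Matrix.diagonal (fun i => (lam x i : ℂ)) * star (U x))
    (hpsd : ∀ x, (ρ x).PosSemidef) (hlam : ∀ x i, 0 ≤ lam x i) (hp : ∀ k x, 0 ≤ p k x) {n : ℕ}
    (hσ : ∀ u : ∀ k, Fin n → X k, (channelOutput ρ u).PosSemidef)
    {a : Finset (Fin K) → ℝ} {b : ℝ} (ha : ∀ J, 0 ≤ a J) (hb : 0 < b)
    [∀ (u : ∀ k, Fin n → X k) y, Decidable (IsTypical p lam a b u y)] (J : Finset (Fin K)) :
    ∑ u, ∑ v, pairWeight (wordProb p n) J u v *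
        ((eigenTest hU (IsTypical p lam (n := n) a b)).test u * channelOutput ρ v).trace.re ≤
      a J * b⁻¹ *
        (∑ x, ∑ y, pairWeight p J x y * subProb p Jᶜ x * (ρ x * ρ y).trace.re) ^ n := by
  have hw : ∀ k y, 0 ≤ wordProb p n k y := fun k y => Finset.prod_nonneg fun i _ => hp _ _
  rw [← sum_pairWeight_purity p (fun x => (hpsd x).isHermitian), Finset.mul_sum]
  refine Finset.sum_le_sum fun u _ => ?_
  rw [Finset.mul_sum]
  refine Finset.sum_le_sum fun v _ => ?_
  have hsub := subProb_nonneg hw Jᶜ u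
  have hl : ∀ y : Fin n → d, 0 ≤ ∏ i, lam (letters u i) (y i) := fun y =>
    Finset.prod_nonneg fun i _ => hlam _ _
  have h := trace_eigenTest_mul_le hU hρ (c := IsTypical p lam (n := n) a b) (u := u)
    (t := a J * b⁻¹ * subProb (wordProb p n) Jᶜ u) (fun y => by
      split_ifs with hc
      · have h1 := hc.1 J
        have h2 := hc.2
        simp only [jointProb] at h2
        rw [Finset.prod_mul_distrib] at h2
        rw [Finset.prod_congr rfl fun i _ => (subProb_mul_compl p J (letters u i)).symm,
          Finset.prod_mul_distrib, ← subProb_wordProb, ← subProb_wordProb] at h2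
        rw [← subProb_wordProb] at h1
        have h3 : b ≤ a J * subProb (wordProb p n) Jᶜ u * ∏ i, lam (letters u i) (y i) :=
          h2.trans (mul_le_mul_of_nonneg_right (mul_le_mul_of_nonneg_right h1 hsub) (hl y))
        calc (1 : ℝ) = b⁻¹ * b := (inv_mul_cancel₀ hb.ne').symm
          _ ≤ b⁻¹ * (a J * subProb (wordProb p n) Jᶜ u * ∏ i, lam (letters u i) (y i)) :=
            mul_le_mul_of_nonneg_left h3 (inv_nonneg.2 hb.le)
          _ = _ := by ring
      · exact mul_nonneg (mul_nonneg (mul_nonneg (ha J) (inv_nonneg.2 hb.le)) hsub) (hl y))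
    (hσ v)
  refine (mul_le_mul_of_nonneg_left h (pairWeight_nonneg hw J u v)).trans (le_of_eq ?_)
  ring

/-- Union bound over the conditions defining typicality, under the joint law of the words and the
eigenvector index. -/
theorem sum_one_sub_eigenTest_le (hU : ∀ x, U x ∈ Matrix.unitaryGroup d ℂ)
    (hρ : ∀ x, ρ x = U x * Matrix.diagonal (fun i => (lam x i : ℂ)) * star (U x))
    (hlam : ∀ x i, 0 ≤ lam x i) (hlam1 : ∀ x, ∑ i, lam x i = 1) (hp : ∀ k x, 0 ≤ p k x) {n : ℕ}
    {a : Finset (Fin K) → ℝ} {b : ℝ}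
    [∀ (u : ∀ k, Fin n → X k) y, Decidable (IsTypical p lam a b u y)] :
    ∑ u, (∏ k, wordProb p n k (u k)) *
        ((1 - (eigenTest hU (IsTypical p lam (n := n) a b)).test u) *
          channelOutput ρ u).trace.re ≤
      ∑ J, ∑ z : Fin n → ∀ k, X k, (if ∏ i, subProb p J (z i) ≤ a J then 0 else
        ∏ i, ∏ k, p k (z i k)) +
      ∑ z : Fin n → (∀ k, X k) × d, (if b ≤ ∏ i, jointProb p lam (z i) then 0 else
        ∏ i, jointProb p lam (z i)) := by
  have hl : ∀ (u : ∀ k, Fin n → X k) (y : Fin n → d), 0 ≤ ∏ i, lam (letters u i) (y i) :=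
    fun u y => Finset.prod_nonneg fun i _ => hlam _ _
  have hP : ∀ z : Fin n → ∀ k, X k, 0 ≤ ∏ i, ∏ k, p k (z i k) :=
    fun z => Finset.prod_nonneg fun i _ => Finset.prod_nonneg fun k _ => hp _ _
  have hl1 : ∀ u : ∀ k, Fin n → X k, ∑ y : Fin n → d, ∏ i, lam (letters u i) (y i) = 1 := by
    intro u
    have h := Finset.prod_univ_sum (fun _ : Fin n => (Finset.univ : Finset d))
      (fun i j => lam (letters u i) j)
    rw [Fintype.piFinset_univ] at h
    rw [← h]
    exact Finset.prod_eq_one fun i _ => hlam1 _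
  have hpt : ∀ u : ∀ k, Fin n → X k, (∏ k, wordProb p n k (u k)) *
      ((1 - (eigenTest hU (IsTypical p lam (n := n) a b)).test u) * channelOutput ρ u).trace.re ≤
      ∑ J, (if ∏ i, subProb p J (letters u i) ≤ a J then 0 else ∏ i, ∏ k, p k (letters u i k)) +
      ∑ y : Fin n → d, (if b ≤ ∏ i, jointProb p lam (letters u i, y i) then 0 else
        ∏ i, jointProb p lam (letters u i, y i)) := by
    intro u
    rw [trace_one_sub_eigenTest_mul hU hρ, prod_wordProb]
    set A := ∑ J, (if ∏ i, subProb p J (letters u i) ≤ a J then 0 else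
      ∏ i, ∏ k, p k (letters u i k)) with hA
    have hA0 : ∀ J, 0 ≤ (if ∏ i, subProb p J (letters u i) ≤ a J then 0 else
        ∏ i, ∏ k, p k (letters u i k)) := by
      intro J
      split_ifs
      · exact le_rfl
      · exact hP _
    have hB0 : ∀ y : Fin n → d, 0 ≤ ∏ i, jointProb p lam (letters u i, y i) := fun y =>
      Finset.prod_nonneg fun i _ => mul_nonneg (Finset.prod_nonneg fun k _ => hp _ _) (hlam _ _)
    -- The input-only term is spread over y with the weights λ_u(y), which sum to 1, so that the
    -- bound can be checked for each y.
    rw [← mul_one A, ← hl1 u, Finset.mul_sum, Finset.mul_sum, ← Finset.sum_add_distrib]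
    refine Finset.sum_le_sum fun y _ => ?_
    have hAnn : 0 ≤ A * ∏ i, lam (letters u i) (y i) :=
      mul_nonneg (Finset.sum_nonneg fun J _ => hA0 J) (hl u y)
    have hq : (∏ i, ∏ k, p k (letters u i k)) * ∏ i, lam (letters u i) (y i) =
        ∏ i, jointProb p lam (letters u i, y i) := by
      simp only [jointProb]
      rw [Finset.prod_mul_distrib]
    split_ifs with h1 h2 h2
    · simpa using hAnn
    · simpa using add_nonneg hAnn (hB0 y)
    · obtain ⟨J, hJ⟩ : ∃ J, ¬ ∏ i, subProb p J (letters u i) ≤ a J := by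
        by_contra! hcon
        exact h1 ⟨hcon, h2⟩
      have h3 := Finset.single_le_sum (fun J _ => hA0 J) (Finset.mem_univ J)
      rw [if_neg hJ] at h3
      rw [add_zero]
      exact mul_le_mul_of_nonneg_right h3 (hl u y)
    · rw [hq]
      exact le_add_of_nonneg_left hAnn
  refine (Finset.sum_le_sum fun u _ => hpt u).trans (le_of_eq ?_)
  rw [Finset.sum_add_distrib, Finset.sum_comm]
  congr 1
  · exact Finset.sum_congr rfl fun J _ => sum_letters (fun z =>
      if ∏ i, subProb p J (z i) ≤ a J then 0 else ∏ i, ∏ k, p k (z i k))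
  · rw [sum_letters (fun z => ∑ y : Fin n → d,
      if b ≤ ∏ i, jointProb p lam (z i, y i) then 0 else ∏ i, jointProb p lam (z i, y i)),
      ← Fintype.sum_prod_type', ← Equiv.sum_comp (Equiv.arrowProdEquivProdArrow (Fin n)
        (fun _ => ∀ k, X k) (fun _ => d))]
    rfl

theorem channelOutput_posSemidef
    (hρ : ∀ x, ρ x = U x * Matrix.diagonal (fun i => (lam x i : ℂ)) * star (U x))
    (hlam : ∀ x i, 0 ≤ lam x i) {n : ℕ} (u : ∀ k, Fin n → X k) :
    (channelOutput ρ u).PosSemidef := by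
  rw [channelOutput_eq hρ]
  exact posSemidef_conj_diagonal _ fun y => Finset.prod_nonneg fun i _ => hlam _ _

/-- Only an inequality, because at t = 0 the right side is 1; this spares a proof that the purity is
nonzero. -/
theorem pow_le_rpow_mul_logb {t : ℝ} (ht : 0 ≤ t) (n : ℕ) :
    t ^ n ≤ (2 : ℝ) ^ ((n : ℝ) * Real.logb 2 t) := by
  rcases ht.eq_or_lt with h | h
  · subst h
    simpa using pow_le_one₀ le_rfl zero_le_one
  · rw [mul_comm, Real.rpow_mul (by norm_num), Real.rpow_logb (by norm_num) (by norm_num) h,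
      Real.rpow_natCast]

/-- Counting only wrong messages absorbs the rounding, since ⌈x⌉ - 1 ≤ x. As J is nonempty, at least
one full δ is gained in the exponent. -/
theorem prod_ceil_sub_one_le {R : Fin K → ℝ} {δ : ℝ} (hδ : 0 < δ) (n : ℕ) {J : Finset (Fin K)}
    (hJ : J.Nonempty) :
    ∏ k ∈ J, ((⌈(2 : ℝ) ^ ((n : ℝ) * (R k - δ))⌉₊ - 1 : ℕ) : ℝ) ≤
      (2 : ℝ) ^ ((n : ℝ) * (∑ k ∈ J, R k - δ)) := by
  have h1 : ∏ k ∈ J, ((⌈(2 : ℝ) ^ ((n : ℝ) * (R k - δ))⌉₊ - 1 : ℕ) : ℝ) ≤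
      ∏ k ∈ J, (2 : ℝ) ^ ((n : ℝ) * (R k - δ)) := by
    refine Finset.prod_le_prod (fun k _ => Nat.cast_nonneg _) fun k _ => ?_
    have hpos : (0 : ℝ) < (2 : ℝ) ^ ((n : ℝ) * (R k - δ)) := by positivity
    have hc := Nat.ceil_lt_add_one hpos.le
    rw [Nat.cast_sub (Nat.one_le_iff_ne_zero.2 (Nat.ceil_pos.2 hpos).ne'), Nat.cast_one]
    linarith
  refine h1.trans ?_
  rw [← Real.rpow_sum_of_pos (by norm_num)]
  refine Real.rpow_le_rpow_of_exponent_le (by norm_num) ?_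
  rw [← Finset.mul_sum, Finset.sum_sub_distrib, Finset.sum_const, nsmul_eq_mul]
  refine mul_le_mul_of_nonneg_left ?_ (Nat.cast_nonneg n)
  have : (1 : ℝ) ≤ (J.card : ℝ) := by exact_mod_cast hJ.card_pos
  nlinarith

/-- The expected error vanishes if all partial rate sums are at most the information
quantities. -/
theorem exists_expected_error_bound (hρ : ∀ x, IsDensityOperator (ρ x))
    (hp : ∀ k, p k ∈ stdSimplex ℝ (X k)) {R : Fin K → ℝ}
    (hR : ∀ J : Finset (Fin K), J.Nonempty → ∑ j ∈ J, R j ≤ renyiInfo J (cqState p ρ))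
    {δ : ℝ} (hδ : 0 < δ) :
    ∃ (r : Finset (Fin K) → ℝ) (s : ℝ), (∀ J, 0 ≤ r J ∧ r J < 1) ∧ 0 ≤ s ∧ s < 1 ∧
      ∀ n : ℕ, ∃ D : SimultaneousDecoder X d n,
        ∑ x : Codebook X n fun k => ⌈(2 : ℝ) ^ ((n : ℝ) * (R k - δ))⌉₊,
          codebookProb p x * (D.code x).avgError ρ ≤
        2 * (∑ J, r J ^ n + s ^ n) +
          4 * ∑ _J ∈ Finset.univ.filter (fun J : Finset (Fin K) => J.Nonempty),
            ((2 : ℝ) ^ (-(δ / 2))) ^ n := by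
  classical
  have hp0 : ∀ k x, 0 ≤ p k x := fun k => (hp k).1
  have hherm : ∀ x, (ρ x).IsHermitian := fun x => (hρ x).1.isHermitian
  set U : (∀ k, X k) → Matrix d d ℂ := fun x => ((hherm x).eigenvectorUnitary : Matrix d d ℂ)
  set lam : (∀ k, X k) → d → ℝ := fun x => (hherm x).eigenvalues
  have hU : ∀ x, U x ∈ Matrix.unitaryGroup d ℂ := fun x => (hherm x).eigenvectorUnitary.2
  have hspec : ∀ x, ρ x = U x * Matrix.diagonal (fun i => (lam x i : ℂ)) * star (U x) := by
    intro x
    have h := (hherm x).spectral_theorem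
    rw [Unitary.conjStarAlgAut_apply] at h
    exact h
  have hlam : ∀ x i, 0 ≤ lam x i := fun x i => (hρ x).1.eigenvalues_nonneg i
  have hlam1 : ∀ x, ∑ i, lam x i = 1 := by
    intro x
    have h := (hherm x).trace_eq_sum_eigenvalues
    rw [(hρ x).2] at h
    exact Complex.ofReal_injective (by push_cast; exact h.symm)
  have hP0 : ∀ x : ∀ k, X k, 0 ≤ ∏ k, p k (x k) := fun x => Finset.prod_nonneg fun k _ => hp0 _ _
  have hP1 : ∑ x : ∀ k, X k, ∏ k, p k (x k) = 1 := sum_prod_eq_one fun k => (hp k).2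
  have hq0 : ∀ z, 0 ≤ jointProb p lam z := fun z => mul_nonneg (hP0 _) (hlam _ _)
  have hq1 : ∑ z, jointProb p lam z = 1 := by
    simp only [jointProb]
    rw [Fintype.sum_prod_type]
    simp only [← Finset.mul_sum, hlam1, mul_one, hP1]
  -- Each typicality threshold loses δ/4, so a_J b⁻¹ loses δ/2, half of the rate reduction δ.
  have hδ' : 0 < δ / 4 := by positivity
  choose r hr0 hr1 hr using fun J : Finset (Fin K) =>
    exists_rate_prod_gt hP0 hP1 (subProb p J) hδ'
  obtain ⟨s, hs0, hs1, hs⟩ := exists_rate_prod_lt hq0 hq1 hδ'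
  refine ⟨r, s, fun J => ⟨hr0 J, hr1 J⟩, hs0, hs1, fun n => ?_⟩
  set a : Finset (Fin K) → ℝ := fun J => (2 : ℝ) ^ ((n : ℝ) *
    (∑ x, (∏ k, p k (x k)) * Real.logb 2 (subProb p J x) + δ / 4)) with ha
  set b : ℝ := (2 : ℝ) ^ ((n : ℝ) *
    (∑ z, jointProb p lam z * Real.logb 2 (jointProb p lam z) - δ / 4)) with hb
  have hb0 : 0 < b := by positivity
  have hσ : ∀ u : ∀ k, Fin n → X k, (channelOutput ρ u).PosSemidef :=
    channelOutput_posSemidef hspec hlam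
  refine ⟨eigenTest hU (IsTypical p lam a b), ?_⟩
  refine (expected_avgError_le hp hσ (fun k => Nat.ceil_pos.2 (by positivity)) _).trans ?_
  refine add_le_add (mul_le_mul_of_nonneg_left ?_ (by norm_num))
    (mul_le_mul_of_nonneg_left (Finset.sum_le_sum fun J hJ => ?_) (by norm_num))
  · refine (sum_one_sub_eigenTest_le hU hspec hlam hlam1 hp0).trans ?_
    exact add_le_add (Finset.sum_le_sum fun J _ => hr J n) (hs n)
  · have hJ' : J.Nonempty := (Finset.mem_filter.1 hJ).2
    have h1 := sum_pairWeight_eigenTest_le hU hspec (fun x => (hρ x).1) hlam hp0 hσ (a := a)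
      (fun J => by positivity) hb0 J
    have hpur0 : 0 ≤ ∑ x, ∑ y, pairWeight p J x y * subProb p Jᶜ x * (ρ x * ρ y).trace.re :=
      Finset.sum_nonneg fun x _ => Finset.sum_nonneg fun y _ =>
        mul_nonneg (mul_nonneg (pairWeight_nonneg hp0 J x y) (subProb_nonneg hp0 _ x))
          (trace_mul_re_nonneg (hρ x).1 (hρ y).1)
    have h2 := h1.trans (mul_le_mul_of_nonneg_left (pow_le_rpow_mul_logb hpur0 n) (by positivity))
    refine (mul_le_mul (prod_ceil_sub_one_le hδ n hJ') h2 ?_ (by positivity)).trans ?_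
    · exact Finset.sum_nonneg fun u _ => Finset.sum_nonneg fun v _ =>
        mul_nonneg (pairWeight_nonneg (fun k y => Finset.prod_nonneg fun i _ => hp0 _ _) J u v)
          (trace_mul_re_nonneg (SimultaneousDecoder.test_nonneg _ u) (hσ v))
    have hRJ := hR J hJ'
    rw [renyiInfo, condEntropy, renyiTwoEntropy, purity_marginalXC,
      vonNeumannEntropy_cqState hU hspec,
      vonNeumannEntropy_marginalX hp (fun x => (hρ x).2)] at hRJ
    -- Everything is now a power of two; the exponents add to at most n(-δ + δ/4 + δ/4) = -nδ/2 once
    -- the rate constraint for J is inserted.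
    rw [ha, hb, ← Real.rpow_neg (by norm_num), ← Real.rpow_add (by norm_num),
      ← Real.rpow_add (by norm_num), ← Real.rpow_add (by norm_num), ← Real.rpow_natCast,
      ← Real.rpow_mul (by norm_num)]
    refine Real.rpow_le_rpow_of_exponent_le (by norm_num) ?_
    have hn : (0 : ℝ) ≤ n := Nat.cast_nonneg n
    have := mul_le_mul_of_nonneg_left hRJ hn
    linarith

end Achievability
end CQMAC

theorem mainTheorem7 {K : ℕ} {X : Fin K → Type u} [∀ k, Fintype (X k)] [∀ k, DecidableEq (X k)]
    {d : Type v} [Fintype d] [DecidableEq d]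
    (ρ : (∀ k, X k) → Matrix d d ℂ) (hρ : ∀ x, CQMAC.IsDensityOperator (ρ x))
    (p : ∀ k, X k → ℝ) (hp : ∀ k, p k ∈ stdSimplex ℝ (X k))
    (R : Fin K → ℝ)
    (hR : ∀ J : Finset (Fin K), J.Nonempty →
      ∑ j ∈ J, R j ≤ CQMAC.renyiInfo J (CQMAC.cqState p ρ)) :
    CQMAC.AchievableSimultaneously p ρ R := by
  intro ε hε _ δ hδ
  obtain ⟨r, s, hr, hs0, hs1, hD⟩ := CQMAC.exists_expected_error_bound hρ hp hR hδ
  -- The bound is a sum of geometric sequences whose number does not depend on n.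
  have hlim : Filter.Tendsto (fun n : ℕ => 2 * (∑ J, r J ^ n + s ^ n) +
      4 * ∑ _J ∈ Finset.univ.filter (fun J : Finset (Fin K) => J.Nonempty),
        ((2 : ℝ) ^ (-(δ / 2))) ^ n) Filter.atTop (nhds (2 * (∑ _J : Finset (Fin K), 0 + 0) +
      4 * ∑ _J ∈ Finset.univ.filter (fun J : Finset (Fin K) => J.Nonempty), 0)) := by
    refine (((tendsto_finsetSum _ fun J _ => ?_).add ?_).const_mul 2).add
      ((tendsto_finsetSum _ fun J _ => ?_).const_mul 4)
    · exact tendsto_pow_atTop_nhds_zero_of_lt_one (hr J).1 (hr J).2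
    · exact tendsto_pow_atTop_nhds_zero_of_lt_one hs0 hs1
    · exact tendsto_pow_atTop_nhds_zero_of_lt_one (by positivity)
        (Real.rpow_lt_one_of_one_lt_of_neg (by norm_num) (by linarith))
  simp only [Finset.sum_const_zero, add_zero, mul_zero] at hlim
  filter_upwards [hlim.eventually (gt_mem_nhds hε)] with n hn
  obtain ⟨D, hD⟩ := hD n
  have hle := hD.trans hn.le
  exact ⟨_, fun k => Nat.le_ceil _, D, hle, CQMAC.exists_avgError_le hp hle⟩
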